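/- Let $p\in\mathbb N^m$, $q\in\mathbb N^n$ with $\sum_i p_i=\sum_j q_j=:c$, and put $a=\max_i p_i$, $b=\max_j q_j$. Let $\mathcal M(p,q)$ be the set of $m\times n$ matrices with row sums $p$ and column sums $q$, with entries in $\{0,1\}$ (binary case) or in $\mathbb N$ ($\mathbb N$-valued case); in the binary case assume that it is nonempty. *Notation.* For $v\in\mathbb N^n$ let $\bar v=(\bar v_1,\bar v_2,\dots)$ with $\bar v_i=\#\{j:v_j=i\}$; let $L$ be the left shift, $Lu=(u_2,u_3,\dots)$. The count of a node $(u,\bar v)$ is the number of matrices (of the given kind) with margins $(u,v)$. The children of $(u,\bar v)$ are the nodes $(Lu,\bar v-s+Ls)$, where $s=(s_1,\dots,s_b)$ runs over the vectors of natural numbers with $\sum_i s_i=u_1$ and $s\le\bar v$ (binary case), respectively $s\le \bar v+Ls$ ($\mathbb N$-valued case). The number of rows that lead to this child is $\prod_i\binom{\bar v_i}{s_i}$, respectively $\prod_i\binom{\bar v_i+s_{i+1}}{s_i}$. *Algorithm (Sampling).* Given is a lookup table with the counts of all nodes, and with the children of each node organized in a balanced binary search tree by their weights, the weight of a child being its count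 times the number of rows that lead to it. Start with $(u,v)=(p,q)$. While $(u,v)\neq(0,0)$: choose a child of $(u,\bar v)$ with probability proportional to its weight, by drawing a uniform integer from $\{1,\dots,\text{count of }(u,\bar v)\}$ and descending the search tree; let $s$ be its vector; choose a row $r$ uniformly among the rows that lead to the child, by choosing for each $i$ ($i=1,\dots,b$ in the binary case, $i=b,\dots,1$ in the $\mathbb N$-valued case), by sampling without replacement, $s_i$ of the columns whose current sum is $i$, and lowering their sums to $i-1$; output the row $r$ and replace $(u,v)$ by $(Lu,v-r)$. *Cost.* Time is the number of machine operations. Arithmetic on and comparison of integers and access to an array position cost $O(1)$, a table lookup at a node costs $O(b)$ (reading its key), columns with sum $0$ are not stored, and a matrix is output as the list of its rows, each a list of columns with multiplicity. Random integers come from a generator that returns, for each $j\ge1$, a uniform element of $\{1,\dots,j\}$, independently in different calls, with an arbitrary random running time, which is at least one operation if $j\ge2$; $T_r(k)$ is the maximum over $1\le j\le k$ of the expected time of such a call. Then: 1. The algorithm returns a uniformly random element of $\mathcal M(p,q)$. 2. If $c\ge1$, its expected time per sample is $$O\bigl(m\,T_r(n^c)+m\,a\,T_r(n)+m\,b\log(a+b)\bigr)\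 \text{ in the binary case, and}$$ $$O\bigl(m\,T_r((2c)^c)+m\,a\,T_r(n)+m\,b\log(a+b)\bigr)\ \text{ in the }\mathbb N\text{-valued case,}$$ with absolute implied constants. 3. If $T_r(k)=O(\log k)$, that is, $T_r(k)\le K\log k$ for all $k\ge k_0$, and if $c\ge2$, then its expected time per sample is $O(mc\log c)$ in both cases, with an implied constant that depends only on $K$ and $k_0$. 4. The hypothesis of 3 holds for rejection sampling from independent fair random bits at unit cost per bit, in which $\lceil\log_2 j\rceil$ bits at a time are read as an integer in $\{1,\dots,2^{\lceil\log_2 j\rceil}\}$ until the integer is at most $j$: for this generator there is a $K$ with $T_r(k)\le K\log k$ for all $k\ge2$. -/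

import Mathlib

open scoped ENNReal NNReal

namespace MarginSampling

/-! ### Randomized computations with a step count -/

/-- A randomized computation with result in `α`: the joint law of the result and of the number of
machine operations used. -/
@[ext]
structure Timed (α : Type) where
  law : PMF (α × ℕ)

namespace Timed

/-- Sequential composition: the second computation uses fresh randomness, the times add up. -/
noncomputable instance : Monad Timed where
  pure a := ⟨PMF.pure (a, 0)⟩
  bind x f := ⟨x.law.bind fun y => PMF.map (fun z => (z.1, y.2 + z.2)) (f y.1).law⟩

/-- Spend `k` machine operations. -/
noncomputable def tick (k : ℕ) : Timed Unit := ⟨PMF.pure ((), k)⟩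

/-- The law of the result. -/
noncomputable def output {α : Type} (x : Timed α) : PMF α := PMF.map Prod.fst x.law

/-- The expected number of machine operations. -/
noncomputable def expectedTime {α : Type} (x : Timed α) : ℝ≥0∞ :=
  ∑' y : α × ℕ, x.law y * (y.2 : ℝ≥0∞)

end Timed

/-- A source of random integers: `draw j` generates an integer uniformly between `1` and `j` (for
`j ≥ 1`), with an arbitrary random running time, which may depend on the value; a choice between
at least two values takes at least one operation. -/
structure UniformGenerator where
  draw : ℕ → Timed ℕ
  uniform : ∀ (j : ℕ) (hj : 1 ≤ j),
    (draw j).output = PMF.uniformOfFinset (Finset.Icc 1 j) (Finset.nonempty_Icc.mpr hj)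
  one_le_time : ∀ j : ℕ, 2 ≤ j → ∀ y ∈ (draw j).law.support, 1 ≤ y.2

/-- `T_r(k)`: the maximum over `1 ≤ j ≤ k` of the expected time to generate a random integer
uniformly between `1` and `j`. -/
noncomputable def UniformGenerator.Tr (G : UniformGenerator) (k : ℕ) : ℝ≥0∞ :=
  ⨆ j ∈ Finset.Icc 1 k, (G.draw j).expectedTime

/-- A fair random bit, at cost one. -/
noncomputable def randomBit : Timed Bool :=
  ⟨PMF.map (fun x => (x, 1)) (PMF.uniformOfFintype Bool)⟩

/-- The number in `{0, …, 2 ^ L - 1}` written by `L` independent fair bits. -/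
noncomputable def randomBits : ℕ → Timed ℕ
  | 0 => pure 0
  | L + 1 => do
    let x ← randomBit
    let y ← randomBits L
    pure (2 * y + x.toNat)

/-- One round of rejection sampling from `{1, …, j}`: read `⌈log₂ j⌉` fair bits, which give a
uniform integer between `1` and `2 ^ ⌈log₂ j⌉`; accept it if it is at most `j`, and otherwise
continue with `retry`. -/
noncomputable def rejectionRound (j : ℕ) (retry : Timed ℕ) : Timed ℕ := do
  let x ← randomBits (Nat.clog 2 j)
  if x + 1 ≤ j then pure (x + 1) else retry

/-! ### Matrices with given margins and their counts -/

/-- The two kinds of matrices: zero-one matrices and matrices of natural numbers. -/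
inductive Kind
  | binary
  | natural

/-- The `m × n` matrices of the given kind with row sums `p` and column sums `q`. -/
def tables (κ : Kind) {m n : ℕ} (p : Fin m → ℕ) (q : Fin n → ℕ) :
    Set (Matrix (Fin m) (Fin n) ℕ) :=
  {X | (κ = Kind.binary → ∀ i j, X i j ≤ 1) ∧
    (∀ i, ∑ j, X i j = p i) ∧ (∀ j, ∑ i, X i j = q j)}

/-- The vector of counts of `v`: its entry at `i` is the number of columns with sum `i`. Only the
entries with `i ≥ 1` are used. -/
def countVec {n : ℕ} (v : Fin n → ℕ) (i : ℕ) : ℕ :=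
  (Finset.univ.filter fun j => v j = i).card

open Classical in
/-- The count of the node `(u, w)`: the number of matrices with row sums `u` and column sums `v`
for any `v` with `n` entries whose vector of counts is `w`. -/
noncomputable def nodeCount (κ : Kind) (n : ℕ) (u : List ℕ) (w : ℕ → ℕ) : ℕ :=
  if h : ∃ v : Fin n → ℕ, ∀ i, 1 ≤ i → countVec v i = w i then
    (tables κ u.get h.choose).ncard
  else 0

open Classical in
/-- The vectors that index the children of a node with first row sum `k` and vector of counts
`w`: the compositions `s` of `k` into parts indexed by `1, …, b` with `s ≤ w` in the binary case,
and with `s ≤ w + L s` in the other case, where `L` is the left shift. -/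
noncomputable def childVectors (κ : Kind) (b k : ℕ) (w : ℕ → ℕ) : Finset (ℕ →₀ ℕ) :=
  match κ with
  | .binary => (Finset.finsuppAntidiag (Finset.Icc 1 b) k).filter
      fun s => ∀ i ∈ Finset.Icc 1 b, s i ≤ w i
  | .natural => (Finset.finsuppAntidiag (Finset.Icc 1 b) k).filter
      fun s => ∀ i ∈ Finset.Icc 1 b, s i ≤ w i + s (i + 1)

/-- The vector of counts `w - s + L s`, which the child indexed by `s` has. -/
def reduce (w : ℕ → ℕ) (s : ℕ →₀ ℕ) (i : ℕ) : ℕ := w i + s (i + 1) - s i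

/-- The number of rows that lead to the child indexed by `s`. -/
def rowCount (κ : Kind) (b : ℕ) (w : ℕ → ℕ) (s : ℕ →₀ ℕ) : ℕ :=
  match κ with
  | .binary => ∏ i ∈ Finset.Icc 1 b, (w i).choose (s i)
  | .natural => ∏ i ∈ Finset.Icc 1 b, (w i + s (i + 1)).choose (s i)

/-! ### The lookup table -/

/-- A binary search tree: `key` is the total weight of the left subtree. -/
inductive SearchTree (α : Type)
  | leaf (a : α)
  | node (key : ℕ) (left right : SearchTree α)

/-- The balanced search tree of a list of weighted items. -/
def SearchTree.build {α : Type} [Inhabited α] : List (α × ℕ) → SearchTree α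
  | [] => .leaf default
  | [x] => .leaf x.1
  | x :: y :: l =>
    .node ((((x :: y :: l).take ((l.length + 2) / 2)).map Prod.snd).sum)
      (SearchTree.build ((x :: y :: l).take ((l.length + 2) / 2)))
      (SearchTree.build ((x :: y :: l).drop ((l.length + 2) / 2)))
  termination_by l => l.length
  decreasing_by
    all_goals simp only [List.length_take, List.length_drop, List.length_cons]; omega

/-- Find the item that owns the number `x` when `{1, …, total weight}` is partitioned into
consecutive blocks, one for each item, whose sizes are the weights. Every step down the tree
costs a comparison and at most one subtraction. -/
noncomputable def SearchTree.search {α : Type} : SearchTree α → ℕ → Timed α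
  | .leaf a, _ => do
    Timed.tick 1
    pure a
  | .node key left right, x => do
    Timed.tick 2
    if x ≤ key then left.search x else right.search (x - key)

/-- The entry of the lookup table at a node: its count, and the children organized in a search
tree. The weight of a child is its count times the number of corresponding rows. -/
structure Entry where
  count : ℕ
  children : SearchTree (ℕ →₀ ℕ)

/-- The entry at the node `(u, w)` with `u = k :: u'`. -/
noncomputable def entry (κ : Kind) (n b k : ℕ) (u' : List ℕ) (w : ℕ → ℕ) : Entry where
  count := nodeCount κ n (k :: u') w
  children := SearchTree.build ((childVectors κ b k w).toList.map fun s =>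
    (s, rowCount κ b w s * nodeCount κ n u' (reduce w s)))

/-! ### The sampling algorithm -/

/-- The current column sums `v`, stored as one array of columns for each value: `B i` lists
the columns `j` with `v j = i`, for `i ≥ 1`. The vector of counts consists of the lengths. -/
abbrev Buckets (n : ℕ) : Type := ℕ → List (Fin n)

/-- The buckets of `q`. Columns with sum zero are ignored. -/
def initialBuckets {n : ℕ} (q : Fin n → ℕ) : Buckets n := fun i =>
  if i = 0 then [] else (List.finRange n).filter fun j => q j = i

/-- Remove the entry at position `i` of an array: overwrite it with the last entry and drop
the last position (a constant number of operations). -/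
def swapRemove {α : Type} (l : List α) (i : ℕ) : List α :=
  match l.getLast? with
  | none => []
  | some z => (l.set i z).dropLast

/-- Sample `k` entries of an array without replacement. The result consists of the entries that
are left and of those that were chosen. Next to the cost of the random integer, each round costs
four operations: read the entry, overwrite it, drop the last position, store the chosen entry. -/
noncomputable def takeColumns (G : UniformGenerator) {n : ℕ} :
    ℕ → List (Fin n) → Timed (List (Fin n) × List (Fin n))
  | 0, l => do
    Timed.tick 1
    pure (l, [])
  | k + 1, l => do
    let x ← G.draw l.length
    Timed.tick 4
    match l[x - 1]? with
    | none => pure (l, [])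
    | some j => do
      let r ← takeColumns G k (swapRemove l (x - 1))
      pure (r.1, j :: r.2)

/-- For each `i` in the given list of values, in this order: choose `s i` of the columns that
currently have sum `i` and lower their sums to `i - 1`. The result consists of the new
buckets and of the list of all chosen columns. A chosen column is written to its new bucket and
to the output, which costs two operations. -/
noncomputable def lowerColumns (G : UniformGenerator) {n : ℕ} (s : ℕ →₀ ℕ) :
    List ℕ → Buckets n → Timed (Buckets n × List (Fin n))
  | [], B => pure (B, [])
  | i :: is, B => do
    Timed.tick 1
    let r ← takeColumns G (s i) (B i)
    Timed.tick (2 * r.2.length)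
    let t ← lowerColumns G s is
      (Function.update (Function.update B i r.1) (i - 1) (r.2 ++ B (i - 1)))
    pure (t.1, r.2 ++ t.2)

/-- The order in which the column sums are treated. In the binary case it increases, so that no
column is lowered twice in a row; otherwise it decreases, so that the columns lowered
from `i + 1` to `i` can be lowered again. -/
def levels (κ : Kind) (b : ℕ) : List ℕ :=
  match κ with
  | .binary => List.range' 1 b
  | .natural => (List.range' 1 b).reverse

/-- The main loop, with the remaining row sums `u` and the buckets of the remaining column sums
`v`. Since `u` and `v` have the same total, `(u, v) = (0, 0)` is tested on the
`b` counts. A lookup costs reading its key, that is the row number and the `b` counts. A row is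
returned as the list of its columns, each repeated as often as the entry says; after
an exit the missing rows are zero. -/
noncomputable def sampleRows (G : UniformGenerator) (κ : Kind) {n : ℕ} (b : ℕ) :
    List ℕ → Buckets n → Timed (List (List (Fin n)))
  | [], _ => do
    Timed.tick b
    pure []
  | k :: u', B => do
    Timed.tick b
    if ∀ i ∈ Finset.Icc 1 b, (B i).length = 0 then
      pure []
    else do
      Timed.tick (b + 1)
      let e := entry κ n b k u' fun i => (B i).length
      let x ← G.draw e.count
      let s ← e.children.search x
      let r ← lowerColumns G s (levels κ b) B
      let rows ← sampleRows G κ b u' r.1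
      pure (r.2 :: rows)

/-- The sampling algorithm on row sums `p` and column sums `q`, given the lookup table.
Initialization copies the at most `b` nonempty buckets and the nonzero columns in them. -/
noncomputable def sample (G : UniformGenerator) (κ : Kind) {m n : ℕ}
    (p : Fin m → ℕ) (q : Fin n → ℕ) : Timed (List (List (Fin n))) := do
  Timed.tick (Finset.univ.sup q + (Finset.univ.filter fun j => q j ≠ 0).card)
  sampleRows G κ (Finset.univ.sup q) (List.ofFn p) (initialBuckets q)

/-- The `m × n` matrix that a list of rows represents. -/
def toMatrix {m n : ℕ} (rows : List (List (Fin n))) : Matrix (Fin m) (Fin n) ℕ :=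
  Matrix.of fun i j => (rows.getD i []).count j

end MarginSampling

open MarginSampling

/-! Correctness. Lowering, for each `i`, `s i` columns with current sum `i` is the same as removing
a row: the vector `s` and the row are both recoverable from the old and new column sums
(`lowered_eq`, `mem_outcomes_levels`). So the vectors left after removing a row with a given sum
split into disjoint classes, one per child, and a class has as many elements as there are rows
leading to that child (`card_outcomes`, `pathCount_levels`). The count of a node depends on the
column sums only up to permutation, so all members of a class have the same count. This gives the
recursion `nodeCount_succ`: the weights of the children add up to the count of the node, hence the
integer drawn always lands in the search tree.

For the law of the output, follow one fixed matrix. The chosen child, then the chosen row, then the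
rest of the matrix have probabilities whose product telescopes to one over the count. Only the lower
bound is proved (`le_expect_takeColumns`, `le_expect_lowerColumns`, `le_expect_sampleRows`):
unfavourable branches can then simply be dropped. Since the lower bounds already add up to one, they
are equalities (`output_sample_apply`).

Time. A matrix is encoded by a map from the units of its row sums to the nonzero columns, so every
count met is at most `N ^ c`, with `N` the number of nonzero columns (`ncard_tables_le`). A node has
at most `(a + 1) ^ b` children, so the search costs `O(b log (a + 1))`, and a row needs at most `a`
draws of columns. These costs add up in `expectedTime_sampleRows_le`; the lower-order terms are then
absorbed into the asserted bounds, using `N ≤ min n c`.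

Rejection sampling is given by a closed form, a geometric number of failures followed by a uniform
value. It satisfies the recursion for one round, and its mean number of rounds is bounded because a
round fails with probability at most one half. -/

namespace MarginSampling

/-! ### Calculus of expectations, expected times and almost sure properties -/

namespace Timed

variable {α β : Type}

/-- The expectation of a function of the result. -/
noncomputable def expect (x : Timed α) (g : α → ℝ≥0∞) : ℝ≥0∞ :=
  ∑' y : α × ℕ, x.law y * g y.1

/-- Every possible result satisfies `P`. -/
def Ensures (x : Timed α) (P : α → Prop) : Prop :=
  ∀ y ∈ x.law.support, P y.1

theorem law_pure (a : α) : (pure a : Timed α).law = PMF.pure (a, 0) := rfl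

theorem law_bind (x : Timed α) (f : α → Timed β) :
    (x >>= f).law = x.law.bind fun y => PMF.map (fun z => (z.1, y.2 + z.2)) (f y.1).law := rfl

theorem tsum_pmf_bind_mul {γ δ : Type} (p : PMF γ) (f : γ → PMF δ) (g : δ → ℝ≥0∞) :
    ∑' z, (p.bind f) z * g z = ∑' y, p y * ∑' z, f y z * g z := by
  simp_rw [PMF.bind_apply, ← ENNReal.tsum_mul_right, ← ENNReal.tsum_mul_left]
  rw [ENNReal.tsum_comm]
  simp_rw [mul_assoc]

theorem tsum_pmf_pure_mul {γ : Type} (a : γ) (g : γ → ℝ≥0∞) :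
    ∑' z, PMF.pure a z * g z = g a := by
  rw [tsum_eq_single a]
  · simp
  · intro b hb; simp [hb]

theorem tsum_pmf_map_mul {γ δ : Type} (p : PMF γ) (f : γ → δ) (g : δ → ℝ≥0∞) :
    ∑' z, (PMF.map f p) z * g z = ∑' y, p y * g (f y) := by
  rw [PMF.map, tsum_pmf_bind_mul]
  simp

theorem expect_pure (a : α) (g : α → ℝ≥0∞) : expect (pure a) g = g a := by
  rw [expect, law_pure, tsum_pmf_pure_mul]

theorem expect_bind (x : Timed α) (f : α → Timed β) (g : β → ℝ≥0∞) :
    expect (x >>= f) g = expect x fun a => expect (f a) g := by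
  rw [expect, law_bind, tsum_pmf_bind_mul]
  simp_rw [tsum_pmf_map_mul]
  rfl

theorem expect_tick (k : ℕ) (g : Unit → ℝ≥0∞) : expect (tick k) g = g () := by
  rw [expect, tick, tsum_pmf_pure_mul]

theorem expect_eq_output (x : Timed α) (g : α → ℝ≥0∞) :
    expect x g = ∑' a, x.output a * g a := by
  rw [output, tsum_pmf_map_mul]; rfl

/-- Values outside the support carry no mass, so the integrands need comparing only where the
invariant `P` holds. -/
theorem expect_mono {x : Timed α} {P : α → Prop} (h : x.Ensures P) {g g' : α → ℝ≥0∞}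
    (hg : ∀ a, P a → g a ≤ g' a) : expect x g ≤ expect x g' := by
  refine ENNReal.tsum_le_tsum fun y => ?_
  by_cases hy : x.law y = 0
  · simp [hy]
  · gcongr
    exact hg _ (h y ((PMF.mem_support_iff _ _).2 hy))

theorem expect_const (x : Timed α) (c : ℝ≥0∞) : expect x (fun _ => c) = c := by
  rw [expect, ENNReal.tsum_mul_right, PMF.tsum_coe, one_mul]

theorem expect_mul_left (x : Timed α) (c : ℝ≥0∞) (g : α → ℝ≥0∞) :
    expect x (fun a => c * g a) = c * expect x g := by
  simp_rw [expect, ← ENNReal.tsum_mul_left, mul_left_comm c]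

theorem expect_le {x : Timed α} {P : α → Prop} (h : x.Ensures P) {g : α → ℝ≥0∞} {c : ℝ≥0∞}
    (hg : ∀ a, P a → g a ≤ c) : expect x g ≤ c :=
  (expect_mono h hg).trans (expect_const x c).le

theorem expectedTime_pure (a : α) : expectedTime (pure a) = 0 := by
  rw [expectedTime, law_pure, tsum_pmf_pure_mul]; simp

theorem expectedTime_tick (k : ℕ) : expectedTime (tick k) = k := by
  rw [expectedTime, tick, tsum_pmf_pure_mul]

theorem expectedTime_bind (x : Timed α) (f : α → Timed β) :
    expectedTime (x >>= f) = expectedTime x + expect x fun a => expectedTime (f a) := by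
  rw [expectedTime, law_bind, tsum_pmf_bind_mul]
  simp_rw [tsum_pmf_map_mul]
  simp only [Nat.cast_add, mul_add, ENNReal.tsum_add, ENNReal.tsum_mul_right, PMF.tsum_coe,
    one_mul]
  rfl

/-- The workhorse of all time bounds: the second stage is estimated uniformly over the results that
the first stage can produce. -/
theorem expectedTime_bind_le {x : Timed α} {f : α → Timed β} {P : α → Prop} {s t : ℝ≥0∞}
    (hx : expectedTime x ≤ s) (h : x.Ensures P) (hf : ∀ a, P a → expectedTime (f a) ≤ t) :
    expectedTime (x >>= f) ≤ s + t := by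
  rw [expectedTime_bind]
  exact add_le_add hx (expect_le h hf)

theorem expectedTime_tick_bind (k : ℕ) (f : Unit → Timed β) :
    expectedTime (tick k >>= f) = k + expectedTime (f ()) := by
  rw [expectedTime_bind, expectedTime_tick, expect_tick]

theorem ensures_pure {a : α} {P : α → Prop} (h : P a) : Ensures (pure a) P := by
  intro y hy
  rw [law_pure, PMF.support_pure] at hy
  rw [Set.mem_singleton_iff.1 hy]
  exact h

theorem ensures_tick (k : ℕ) : Ensures (tick k) fun _ => True := fun _ _ => trivial

theorem Ensures.mono {x : Timed α} {P Q : α → Prop} (h : x.Ensures P) (hPQ : ∀ a, P a → Q a) :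
    x.Ensures Q := fun y hy => hPQ _ (h y hy)

theorem Ensures.bind {x : Timed α} {f : α → Timed β} {P : α → Prop} {Q : β → Prop}
    (h : x.Ensures P) (hf : ∀ a, P a → (f a).Ensures Q) : (x >>= f).Ensures Q := by
  intro y hy
  rw [law_bind, PMF.mem_support_bind_iff] at hy
  obtain ⟨z, hz, hy⟩ := hy
  rw [PMF.mem_support_map_iff] at hy
  obtain ⟨t, ht, rfl⟩ := hy
  exact hf _ (h z hz) t ht

theorem ensures_true (x : Timed α) : x.Ensures fun _ => True := fun _ _ => trivial

theorem Ensures.tick_bind {k : ℕ} {f : Unit → Timed β} {Q : β → Prop} (h : (f ()).Ensures Q) :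
    (tick k >>= f).Ensures Q := (ensures_tick k).bind fun _ _ => h

theorem ensures_of_output {x : Timed α} {P : α → Prop} (h : ∀ a ∈ x.output.support, P a) :
    x.Ensures P := fun y hy => h _ ((PMF.mem_support_map_iff _ _ _).2 ⟨y, hy, rfl⟩)

end Timed

open Timed

/-! ### Uniform random integers -/

theorem mul_tsum_uniform {j : ℕ} (hj : 1 ≤ j) (g : ℕ → ℝ≥0∞) :
    (j : ℝ≥0∞) * ∑' x, PMF.uniformOfFinset (Finset.Icc 1 j) (Finset.nonempty_Icc.mpr hj) x * g x =
      ∑ x ∈ Finset.range j, g (x + 1) := by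
  have h1 : ∑ x ∈ Finset.range j, g (x + 1) = ∑ x ∈ Finset.Icc 1 j, g x := by
    rw [Finset.range_eq_Ico, Finset.sum_Ico_add' (fun x => g x)]
    rfl
  rw [h1, tsum_eq_sum (s := Finset.Icc 1 j)]
  · rw [Finset.mul_sum]
    refine Finset.sum_congr rfl fun x hx => ?_
    rw [PMF.uniformOfFinset_apply_of_mem _ hx, ← mul_assoc, Nat.card_Icc, Nat.add_sub_cancel,
      ENNReal.mul_inv_cancel (by exact_mod_cast (by omega : j ≠ 0)) (ENNReal.natCast_ne_top j),
      one_mul]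
  · intro x hx
    rw [PMF.uniformOfFinset_apply_of_notMem _ hx, zero_mul]

namespace UniformGenerator

variable (G : UniformGenerator)

theorem ensures_draw {j : ℕ} (hj : 1 ≤ j) : (G.draw j).Ensures fun x => 1 ≤ x ∧ x ≤ j := by
  refine ensures_of_output fun a ha => ?_
  rw [G.uniform j hj, PMF.mem_support_uniformOfFinset_iff] at ha
  exact Finset.mem_Icc.1 ha

/-- Stated without division: the counts then cancel as natural numbers when the stages of the
algorithm are composed. -/
theorem mul_expect_draw {j : ℕ} (hj : 1 ≤ j) (g : ℕ → ℝ≥0∞) :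
    (j : ℝ≥0∞) * expect (G.draw j) g = ∑ x ∈ Finset.range j, g (x + 1) := by
  rw [expect_eq_output, G.uniform j hj, mul_tsum_uniform hj]

theorem expectedTime_draw_le {j k : ℕ} (hj : 1 ≤ j) (hjk : j ≤ k) :
    (G.draw j).expectedTime ≤ G.Tr k :=
  le_iSup₂ (f := fun i (_ : i ∈ Finset.Icc 1 k) => (G.draw i).expectedTime) j
    (Finset.mem_Icc.2 ⟨hj, hjk⟩)

theorem Tr_mono {j k : ℕ} (h : j ≤ k) : G.Tr j ≤ G.Tr k :=
  iSup₂_le fun _ hi =>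
    G.expectedTime_draw_le (Finset.mem_Icc.1 hi).1 ((Finset.mem_Icc.1 hi).2.trans h)

/-- Lets the constant overhead per chosen column be absorbed into the cost of the draws. -/
theorem one_le_Tr {k : ℕ} (hk : 2 ≤ k) : 1 ≤ G.Tr k := by
  refine le_trans ?_ (G.expectedTime_draw_le (le_of_lt hk) le_rfl)
  rw [← PMF.tsum_coe (G.draw k).law, expectedTime]
  refine ENNReal.tsum_le_tsum fun y => ?_
  by_cases hy : (G.draw k).law y = 0
  · simp [hy]
  · have := G.one_le_time k hk y ((PMF.mem_support_iff _ _).2 hy)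
    exact le_mul_of_one_le_right zero_le (by exact_mod_cast this)

end UniformGenerator

/-! ### Lowering column sums -/

section Outcomes

variable {n : ℕ}

/-- The columns with sum `i`. -/
def level (v : Fin n → ℕ) (i : ℕ) : Finset (Fin n) := Finset.univ.filter fun j => v j = i

theorem mem_level {v : Fin n → ℕ} {i : ℕ} {j : Fin n} : j ∈ level v i ↔ v j = i := by
  simp [level]

theorem card_level (v : Fin n → ℕ) (i : ℕ) : (level v i).card = countVec v i := rfl

/-- Lower the sums of the columns in `S` by one. -/
def lower (v : Fin n → ℕ) (S : Finset (Fin n)) (j : Fin n) : ℕ := if j ∈ S then v j - 1 else v j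

theorem lower_le (v : Fin n → ℕ) (S : Finset (Fin n)) (j : Fin n) : lower v S j ≤ v j := by
  unfold lower; split_ifs <;> omega

/-- The vectors that can arise when, for each `i` in a list, `s i` of the columns with
current sum `i` are lowered. -/
def outcomes (s : ℕ →₀ ℕ) : List ℕ → (Fin n → ℕ) → Finset (Fin n → ℕ)
  | [], v => {v}
  | i :: is, v => ((level v i).powersetCard (s i)).biUnion fun S => outcomes s is (lower v S)

theorem mem_outcomes_cons {s : ℕ →₀ ℕ} {i : ℕ} {is : List ℕ} {v v' : Fin n → ℕ} :
    v' ∈ outcomes s (i :: is) v ↔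
      ∃ S, S ⊆ level v i ∧ S.card = s i ∧ v' ∈ outcomes s is (lower v S) := by
  simp [outcomes, Finset.mem_powersetCard, and_assoc]

theorem outcomes_le {s : ℕ →₀ ℕ} {is : List ℕ} {v v' : Fin n → ℕ} (h : v' ∈ outcomes s is v)
    (j : Fin n) : v' j ≤ v j := by
  induction is generalizing v with
  | nil => rw [outcomes, Finset.mem_singleton] at h; rw [h]
  | cons i is ih =>
    obtain ⟨S, -, -, h⟩ := mem_outcomes_cons.1 h
    exact (ih h).trans (lower_le v S j)

theorem outcomes_eq {s : ℕ →₀ ℕ} {is : List ℕ} {v v' : Fin n → ℕ} (h : v' ∈ outcomes s is v)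
    {j : Fin n} (hj : v j ∉ is) : v' j = v j := by
  induction is generalizing v with
  | nil => rw [outcomes, Finset.mem_singleton] at h; rw [h]
  | cons i is ih =>
    obtain ⟨S, hS, -, h⟩ := mem_outcomes_cons.1 h
    rw [List.mem_cons, not_or] at hj
    have hjS : j ∉ S := fun hjS => hj.1 (mem_level.1 (hS hjS))
    have hl : lower v S j = v j := if_neg hjS
    rw [ih h (hl ▸ hj.2), hl]

/-- Sums never increase, and level `i` is not treated again: a chosen column ends below `i`, and a
column left at `i` stays there. So different choices have different outcomes. -/
theorem lowered_eq {s : ℕ →₀ ℕ} {i : ℕ} {is : List ℕ} {v v' : Fin n → ℕ} {S : Finset (Fin n)}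
    (hi : 1 ≤ i) (his : i ∉ is) (hS : S ⊆ level v i) (h : v' ∈ outcomes s is (lower v S)) :
    S = (level v i).filter fun j => v' j < i := by
  ext j
  rw [Finset.mem_filter]
  constructor
  · intro hj
    refine ⟨hS hj, ?_⟩
    have h1 := outcomes_le h j
    have h2 := mem_level.1 (hS hj)
    rw [lower, if_pos hj] at h1
    omega
  · rintro ⟨hj, hlt⟩
    by_contra hjS
    have hl : lower v S j = i := (if_neg hjS).trans (mem_level.1 hj)
    have := outcomes_eq h (j := j) (by rwa [hl])
    omega

theorem mem_outcomes_cons' {s : ℕ →₀ ℕ} {i : ℕ} {is : List ℕ} {v v' : Fin n → ℕ}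
    (hi : 1 ≤ i) (his : i ∉ is) :
    v' ∈ outcomes s (i :: is) v ↔ ((level v i).filter fun j => v' j < i).card = s i ∧
      v' ∈ outcomes s is (lower v ((level v i).filter fun j => v' j < i)) := by
  rw [mem_outcomes_cons]
  constructor
  · rintro ⟨S, hS, hc, h⟩
    rw [← lowered_eq hi his hS h]
    exact ⟨hc, h⟩
  · rintro ⟨hc, h⟩
    exact ⟨_, Finset.filter_subset _ _, hc, h⟩

theorem level_lower {v : Fin n → ℕ} {i : ℕ} {S : Finset (Fin n)} (hi : 1 ≤ i)
    (hS : S ⊆ level v i) : level (lower v S) i = level v i \ S := by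
  ext j
  rw [Finset.mem_sdiff, mem_level, mem_level, lower]
  split_ifs with h
  · have := mem_level.1 (hS h); simp [h]; omega
  · simp [h]

theorem level_lower_pred {v : Fin n → ℕ} {i : ℕ} {S : Finset (Fin n)}
    (hS : S ⊆ level v i) : level (lower v S) (i - 1) = S ∪ level v (i - 1) := by
  ext j
  rw [Finset.mem_union, mem_level, mem_level, lower]
  split_ifs with h
  · have := mem_level.1 (hS h); simp [h, this]
  · simp [h]

theorem level_lower_of_ne {v : Fin n → ℕ} {i k : ℕ} {S : Finset (Fin n)}
    (hS : S ⊆ level v i) (hk : k ≠ i) (hk' : k ≠ i - 1) : level (lower v S) k = level v k := by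
  ext j
  rw [mem_level, mem_level, lower]
  split_ifs with h
  · have := mem_level.1 (hS h); omega
  · rfl

theorem disjoint_level_pred {v : Fin n → ℕ} {i : ℕ} {S : Finset (Fin n)} (hi : 1 ≤ i)
    (hS : S ⊆ level v i) : Disjoint S (level v (i - 1)) := by
  rw [Finset.disjoint_left]
  intro j hj hj'
  have h1 := mem_level.1 (hS hj)
  have h2 := mem_level.1 hj'
  omega

/-- The effect on the vector of counts of lowering `k` columns from `i`. -/
def lowerCounts (w : ℕ → ℕ) (i k : ℕ) : ℕ → ℕ :=
  Function.update (Function.update w i (w i - k)) (i - 1) (k + w (i - 1))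

theorem countVec_lower {v : Fin n → ℕ} {i : ℕ} {S : Finset (Fin n)} (hi : 1 ≤ i)
    (hS : S ⊆ level v i) : countVec (lower v S) = lowerCounts (countVec v) i S.card := by
  funext k
  rw [← card_level, lowerCounts]
  by_cases hk' : k = i - 1
  · subst hk'
    rw [Function.update_self, level_lower_pred hS,
      Finset.card_union_of_disjoint (disjoint_level_pred hi hS), card_level]
  · rw [Function.update_of_ne hk']
    by_cases hk : k = i
    · subst hk
      rw [Function.update_self, level_lower hi hS, Finset.card_sdiff_of_subset hS, card_level]
    · rw [Function.update_of_ne hk, level_lower_of_ne hS hk hk', card_level]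

/-- The number of ways to lower, for each `i` in a list, `s i` columns with current sum `i`. -/
def pathCount (s : ℕ →₀ ℕ) : List ℕ → (ℕ → ℕ) → ℕ
  | [], _ => 1
  | i :: is, w => (w i).choose (s i) * pathCount s is (lowerCounts w i (s i))

/-- The vector of counts after lowering. -/
def finalCounts (s : ℕ →₀ ℕ) : List ℕ → (ℕ → ℕ) → ℕ → ℕ
  | [], w => w
  | i :: is, w => finalCounts s is (lowerCounts w i (s i))

/-- By `lowered_eq` different choices at the first level have disjoint sets of outcomes. These sets
have equal size, because the counts after a choice depend only on its cardinality. -/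
theorem card_outcomes (s : ℕ →₀ ℕ) {is : List ℕ} (his : is.Nodup) (hpos : ∀ i ∈ is, 1 ≤ i)
    (v : Fin n → ℕ) : (outcomes s is v).card = pathCount s is (countVec v) := by
  induction is generalizing v with
  | nil => simp [outcomes, pathCount]
  | cons i is ih =>
    rw [List.nodup_cons] at his
    have hi := hpos i List.mem_cons_self
    rw [outcomes, Finset.card_biUnion, pathCount]
    · rw [Finset.sum_congr rfl (g := fun _ => pathCount s is (lowerCounts (countVec v) i (s i))),
        Finset.sum_const, Finset.card_powersetCard, card_level, smul_eq_mul]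
      intro S hS
      rw [Finset.mem_powersetCard] at hS
      rw [ih his.2 (fun k hk => hpos k (List.mem_cons_of_mem _ hk)), countVec_lower hi hS.1, hS.2]
    · intro S hS T hT hST
      rw [Finset.mem_coe, Finset.mem_powersetCard] at hS hT
      refine Finset.disjoint_left.2 fun v' h h' => hST ?_
      rw [lowered_eq hi his.1 hS.1 h, ← lowered_eq hi his.1 hT.1 h']

theorem countVec_of_mem_outcomes {s : ℕ →₀ ℕ} {is : List ℕ} (hpos : ∀ i ∈ is, 1 ≤ i)
    {v v' : Fin n → ℕ} (h : v' ∈ outcomes s is v) :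
    countVec v' = finalCounts s is (countVec v) := by
  induction is generalizing v with
  | nil => rw [outcomes, Finset.mem_singleton] at h; rw [h, finalCounts]
  | cons i is ih =>
    obtain ⟨S, hS, hc, h⟩ := mem_outcomes_cons.1 h
    rw [ih (fun k hk => hpos k (List.mem_cons_of_mem _ hk)) h,
      countVec_lower (hpos i List.mem_cons_self) hS, hc, finalCounts]

end Outcomes

/-! ### The order of the levels -/

section Levels

theorem nodup_levels (κ : Kind) (b : ℕ) : (levels κ b).Nodup := by
  cases κ
  · exact List.nodup_range'
  · exact List.nodup_reverse.2 List.nodup_range'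

theorem mem_levels {κ : Kind} {b i : ℕ} : i ∈ levels κ b ↔ 1 ≤ i ∧ i ≤ b := by
  cases κ <;> simp [levels, List.mem_range'_1] <;> omega

theorem reverse_range'_succ (b : ℕ) :
    (List.range' 1 (b + 1)).reverse = (b + 1) :: (List.range' 1 b).reverse := by
  rw [List.range'_concat, List.reverse_append]; simp [add_comm]

/-- In increasing order, treating a level changes only its own count and the one below, so every
later level still has its original count. -/
theorem pathCount_range' (s : ℕ →₀ ℕ) (a k : ℕ) (ha : 1 ≤ a) (w : ℕ → ℕ) :
    pathCount s (List.range' a k) w = ∏ i ∈ Finset.Ico a (a + k), (w i).choose (s i) := by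
  induction k generalizing a w with
  | zero => simp [pathCount]
  | succ k ih =>
    rw [List.range'_succ, pathCount, ih (a + 1) (by omega),
      Finset.prod_eq_prod_Ico_succ_bot (by omega : a < a + (k + 1))]
    congr 1
    refine Finset.prod_congr (by congr 1; omega) fun i hi => ?_
    rw [Finset.mem_Ico] at hi
    rw [lowerCounts, Function.update_of_ne (by omega), Function.update_of_ne (by omega)]

theorem finalCounts_range' (s : ℕ →₀ ℕ) (a k : ℕ) (ha : 1 ≤ a) (w : ℕ → ℕ) (i : ℕ)
    (hs : ∀ i ∈ Finset.Ico a (a + k), s i ≤ w i) :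
    finalCounts s (List.range' a k) w i =
      (w i - if a ≤ i ∧ i < a + k then s i else 0) +
        if a ≤ i + 1 ∧ i + 1 < a + k then s (i + 1) else 0 := by
  induction k generalizing a w with
  | zero => rw [if_neg (by omega), if_neg (by omega)]; simp [finalCounts]
  | succ k ih =>
    rw [List.range'_succ, finalCounts, ih (a + 1) (by omega)]
    · have := hs a (by simp)
      simp only [lowerCounts, Function.update_apply]
      by_cases h1 : i = a - 1
      · subst h1
        have e : a - 1 + 1 = a := by omega
        rw [e]
        split_ifs <;> omega
      · by_cases h2 : i = a
        · subst h2; split_ifs <;> omega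
        · split_ifs <;> omega
    · intro i hi
      have := hs i (by simp at hi ⊢; omega)
      simp at hi
      rwa [lowerCounts, Function.update_of_ne (by omega), Function.update_of_ne (by omega)]

/-- In decreasing order, the `s (i + 1)` columns lowered from `i + 1` have joined level `i` before
it is treated. Nothing reaches the top level, whence the case distinction. -/
theorem pathCount_reverse (s : ℕ →₀ ℕ) (b : ℕ) (w : ℕ → ℕ) :
    pathCount s (List.range' 1 b).reverse w =
      ∏ i ∈ Finset.Icc 1 b, (w i + if i < b then s (i + 1) else 0).choose (s i) := by
  induction b generalizing w with
  | zero => simp [pathCount]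
  | succ b ih =>
    rw [reverse_range'_succ, pathCount, ih, Finset.prod_Icc_succ_top (by omega), mul_comm]
    congr 1
    · refine Finset.prod_congr rfl fun i hi => ?_
      rw [Finset.mem_Icc] at hi
      rw [if_pos (by omega : i < b + 1), lowerCounts]
      by_cases h : i = b
      · subst h
        rw [if_neg (lt_irrefl _), Nat.add_sub_cancel, Function.update_self, add_zero, add_comm]
      · rw [if_pos (by omega), Nat.add_sub_cancel, Function.update_of_ne h,
          Function.update_of_ne (by omega)]
    · simp

theorem finalCounts_reverse (s : ℕ →₀ ℕ) (b : ℕ) (w : ℕ → ℕ) (i : ℕ) (hi : 1 ≤ i) :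
    finalCounts s (List.range' 1 b).reverse w i =
      (w i + if i < b then s (i + 1) else 0) - if i ≤ b then s i else 0 := by
  induction b generalizing w with
  | zero => rw [if_neg (by omega), if_neg (by omega)]; simp [finalCounts]
  | succ b ih =>
    rw [reverse_range'_succ, finalCounts, ih]
    simp only [lowerCounts, Function.update_apply, Nat.add_sub_cancel]
    by_cases h1 : i = b
    · subst h1; split_ifs <;> omega
    · by_cases h2 : i = b + 1
      · subst h2; split_ifs <;> omega
      · split_ifs <;> omega

theorem mem_childVectors_binary {b k : ℕ} {w : ℕ → ℕ} {s : ℕ →₀ ℕ} :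
    s ∈ childVectors .binary b k w ↔ s ∈ Finset.finsuppAntidiag (Finset.Icc 1 b) k ∧
      ∀ i ∈ Finset.Icc 1 b, s i ≤ w i := by
  classical
  simp only [childVectors, Finset.mem_filter]

theorem mem_childVectors_natural {b k : ℕ} {w : ℕ → ℕ} {s : ℕ →₀ ℕ} :
    s ∈ childVectors .natural b k w ↔ s ∈ Finset.finsuppAntidiag (Finset.Icc 1 b) k ∧
      ∀ i ∈ Finset.Icc 1 b, s i ≤ w i + s (i + 1) := by
  classical
  simp only [childVectors, Finset.mem_filter]

theorem support_of_mem_childVectors {κ : Kind} {b k : ℕ} {w : ℕ → ℕ} {s : ℕ →₀ ℕ}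
    (hs : s ∈ childVectors κ b k w) : s ∈ Finset.finsuppAntidiag (Finset.Icc 1 b) k := by
  cases κ
  · exact (mem_childVectors_binary.1 hs).1
  · exact (mem_childVectors_natural.1 hs).1

theorem eq_zero_of_mem_childVectors {κ : Kind} {b k : ℕ} {w : ℕ → ℕ} {s : ℕ →₀ ℕ}
    (hs : s ∈ childVectors κ b k w) {i : ℕ} (hi : b < i) : s i = 0 := by
  have := (Finset.mem_finsuppAntidiag.1 (support_of_mem_childVectors hs)).2
  by_contra h
  have := this (Finsupp.mem_support_iff.2 h)
  simp at this
  omega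

theorem sum_of_mem_childVectors {κ : Kind} {b k : ℕ} {w : ℕ → ℕ} {s : ℕ →₀ ℕ}
    (hs : s ∈ childVectors κ b k w) : ∑ i ∈ Finset.Icc 1 b, s i = k :=
  (Finset.mem_finsuppAntidiag.1 (support_of_mem_childVectors hs)).1

theorem childVectors_congr {κ : Kind} {b k : ℕ} {w w' : ℕ → ℕ} (h : ∀ i, 1 ≤ i → w i = w' i) :
    childVectors κ b k w = childVectors κ b k w' := by
  ext s
  cases κ
  · rw [mem_childVectors_binary, mem_childVectors_binary]
    refine and_congr_right fun _ => forall₂_congr fun i hi => ?_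
    rw [h i (Finset.mem_Icc.1 hi).1]
  · rw [mem_childVectors_natural, mem_childVectors_natural]
    refine and_congr_right fun _ => forall₂_congr fun i hi => ?_
    rw [h i (Finset.mem_Icc.1 hi).1]

/-- Membership in `childVectors` enters only through `s (b + 1) = 0`, which removes the boundary
case at the top level. -/
theorem pathCount_levels {κ : Kind} {b k : ℕ} {w : ℕ → ℕ} {s : ℕ →₀ ℕ}
    (hs : s ∈ childVectors κ b k w) (w' : ℕ → ℕ) :
    pathCount s (levels κ b) w' = rowCount κ b w' s := by
  cases κ
  · rw [levels, pathCount_range' _ _ _ le_rfl, rowCount, add_comm]; rfl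
  · rw [levels, pathCount_reverse, rowCount]
    refine Finset.prod_congr rfl fun i hi => ?_
    rw [Finset.mem_Icc] at hi
    split_ifs with h
    · rfl
    · rw [eq_zero_of_mem_childVectors hs (by omega : b < i + 1)]

theorem finalCounts_levels {κ : Kind} {b k : ℕ} {w : ℕ → ℕ} {s : ℕ →₀ ℕ}
    (hs : s ∈ childVectors κ b k w) {i : ℕ} (hi : 1 ≤ i) :
    finalCounts s (levels κ b) w i = reduce w s i := by
  have h0 := fun i => eq_zero_of_mem_childVectors (i := i) hs
  cases κ
  · have hle := (mem_childVectors_binary.1 hs).2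
    rw [levels, finalCounts_range' _ _ _ le_rfl, reduce]
    · have := h0 i
      have := h0 (i + 1)
      by_cases hib : i ≤ b
      · have := hle i (by simp; omega)
        split_ifs <;> omega
      · split_ifs <;> omega
    · intro i hi
      exact hle i (by simp at hi ⊢; omega)
  · rw [levels, finalCounts_reverse _ _ _ _ hi, reduce]
    have := h0 i
    have := h0 (i + 1)
    split_ifs <;> omega

end Levels

/-! ### Removing the first row -/

section Steps

variable {n : ℕ}

/-- The column sums `v'` arise from `v` by removing a row of the given kind. -/
def IsStep (κ : Kind) (v v' : Fin n → ℕ) : Prop :=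
  (∀ j, v' j ≤ v j) ∧ (κ = .binary → ∀ j, v j ≤ v' j + 1)

/-- The columns that are lowered from `i` to `i - 1` on the way from `v` to `v'`. -/
def lowered (κ : Kind) (v v' : Fin n → ℕ) (i : ℕ) : Finset (Fin n) :=
  match κ with
  | .binary => Finset.univ.filter fun j => v j = i ∧ v' j < i
  | .natural => Finset.univ.filter fun j => v' j < i ∧ i ≤ v j

theorem lower_filter (v v' : Fin n → ℕ) (i : ℕ) (j : Fin n) :
    lower v ((level v i).filter fun j => v' j < i) j =
      if v j = i ∧ v' j < i then v j - 1 else v j := by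
  simp [lower, level]

/-- A lowered column falls to a level that will not be treated again, so it loses exactly one; the
levels can therefore be read off from the original `v`. -/
theorem mem_outcomes_range' (s : ℕ →₀ ℕ) (a k : ℕ) (ha : 1 ≤ a) (v v' : Fin n → ℕ) :
    v' ∈ outcomes s (List.range' a k) v ↔ (∀ j, v' j ≤ v j ∧ v j ≤ v' j + 1) ∧
      (∀ j, ¬ (a ≤ v j ∧ v j < a + k) → v' j = v j) ∧
      ∀ i, a ≤ i → i < a + k → (Finset.univ.filter fun j => v j = i ∧ v' j < i).card = s i := by
  induction k generalizing a v with
  | zero =>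
    rw [List.range'_zero, outcomes, Finset.mem_singleton, funext_iff]
    constructor
    · intro h
      exact ⟨fun j => by rw [h j]; omega, fun j _ => h j, fun i _ _ => by omega⟩
    · rintro ⟨-, h, -⟩ j
      exact h j (by omega)
  | succ k ih =>
    rw [List.range'_succ, mem_outcomes_cons' ha (by simp [List.mem_range'_1]), ih (a + 1) (by omega)]
    set u := lower v ((level v a).filter fun j => v' j < a) with hu
    have hl : ∀ j, u j = if v j = a ∧ v' j < a then v j - 1 else v j := lower_filter v v' a
    have hc : ∀ i, a + 1 ≤ i → (Finset.univ.filter fun j => u j = i ∧ v' j < i) =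
        Finset.univ.filter fun j => v j = i ∧ v' j < i := by
      intro i hi
      refine Finset.filter_congr fun j _ => ?_
      rw [hl j]
      split_ifs <;> omega
    have ha' : (level v a).filter (fun j => v' j < a) =
        Finset.univ.filter fun j => v j = a ∧ v' j < a := by
      rw [level, Finset.filter_filter]
    rw [ha']
    constructor
    · rintro ⟨h0, h1, h2, h3⟩
      refine ⟨fun j => ?_, fun j hj => ?_, fun i hi hi' => ?_⟩
      · have h4 := h1 j
        have h5 := h2 j
        rw [hl j] at h4 h5
        split_ifs at h4 h5 <;> omega
      · have h5 := h2 j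
        rw [hl j] at h5
        split_ifs at h5 <;> omega
      · rcases hi.eq_or_lt with rfl | hi
        · exact h0
        · rw [← hc i hi]; exact h3 i hi (by omega)
    · rintro ⟨h1, h2, h3⟩
      refine ⟨h3 a le_rfl (by omega), fun j => ?_, fun j hj => ?_, fun i hi hi' => ?_⟩
      · have h4 := h1 j
        rw [hl j]
        split_ifs <;> omega
      · have h4 := h1 j
        have h5 := h2 j
        rw [hl j] at hj ⊢
        split_ifs at hj ⊢ <;> omega
      · rw [hc i hi]; exact h3 i (by omega) (by omega)

/-- A column may fall through several consecutive levels. It is chosen at `i` exactly when it starts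
at or above `i` and ends below. -/
theorem mem_outcomes_reverse (s : ℕ →₀ ℕ) (b : ℕ) (v v' : Fin n → ℕ) :
    v' ∈ outcomes s (List.range' 1 b).reverse v ↔ (∀ j, v' j ≤ v j) ∧
      (∀ j, b < v j → v' j = v j) ∧
      ∀ i, 1 ≤ i → i ≤ b → (Finset.univ.filter fun j => v' j < i ∧ i ≤ v j).card = s i := by
  induction b generalizing v with
  | zero =>
    rw [List.range'_zero, List.reverse_nil, outcomes, Finset.mem_singleton, funext_iff]
    constructor
    · intro h
      exact ⟨fun j => (h j).le, fun j _ => h j, fun i _ _ => by omega⟩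
    · rintro ⟨h, h', -⟩ j
      have := h j
      have := h' j
      omega
  | succ b ih =>
    rw [reverse_range'_succ,
      mem_outcomes_cons' (by omega) (by simp [List.mem_range'_1]; omega), ih]
    set u := lower v ((level v (b + 1)).filter fun j => v' j < b + 1) with hu
    have hl : ∀ j, u j = if v j = b + 1 ∧ v' j < b + 1 then v j - 1 else v j :=
      lower_filter v v' (b + 1)
    rw [level, Finset.filter_filter]
    have hc : (∀ j, b + 1 < v j → v' j = v j) → ∀ i, i ≤ b →
        (Finset.univ.filter fun j => v' j < i ∧ i ≤ u j) =
        Finset.univ.filter fun j => v' j < i ∧ i ≤ v j := by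
      intro h i hi
      refine Finset.filter_congr fun j _ => ?_
      rw [hl j]
      split_ifs <;> omega
    -- Columns above the top level are fixed, so those that cross it start exactly on it.
    have ht : (∀ j, b + 1 < v j → v' j = v j) →
        (Finset.univ.filter fun j => v j = b + 1 ∧ v' j < b + 1) =
        Finset.univ.filter fun j => v' j < b + 1 ∧ b + 1 ≤ v j := by
      intro h
      refine Finset.filter_congr fun j _ => ?_
      have := h j
      omega
    constructor
    · rintro ⟨h0, h1, h2, h3⟩
      have h4 : ∀ j, b + 1 < v j → v' j = v j := by
        intro j hj
        have h5 := h2 j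
        rw [hl j] at h5
        split_ifs at h5 <;> omega
      refine ⟨fun j => ?_, h4, fun i hi hi' => ?_⟩
      · have h4 := h1 j
        rw [hl j] at h4
        split_ifs at h4 <;> omega
      · rcases hi'.eq_or_lt with rfl | hi'
        · rw [← ht h4]; exact h0
        · rw [← hc h4 i (by omega)]; exact h3 i hi (by omega)
    · rintro ⟨h1, h2, h3⟩
      refine ⟨?_, fun j => ?_, fun j hj => ?_, fun i hi hi' => ?_⟩
      · rw [ht h2]; exact h3 _ (by omega) le_rfl
      · have h4 := h1 j
        rw [hl j]
        split_ifs <;> omega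
      · have h4 := h1 j
        have h5 := h2 j
        rw [hl j] at hj ⊢
        split_ifs at hj ⊢ <;> omega
      · rw [hc h2 i hi']; exact h3 i hi (by omega)

theorem mem_outcomes_levels {κ : Kind} {s : ℕ →₀ ℕ} {b : ℕ} {v v' : Fin n → ℕ}
    (hv : ∀ j, v j ≤ b) : v' ∈ outcomes s (levels κ b) v ↔
      IsStep κ v v' ∧ ∀ i ∈ Finset.Icc 1 b, (lowered κ v v' i).card = s i := by
  cases κ
  · rw [levels, mem_outcomes_range' _ _ _ le_rfl]
    constructor
    · rintro ⟨h1, h2, h3⟩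
      refine ⟨⟨fun j => (h1 j).1, fun _ j => (h1 j).2⟩, fun i hi => ?_⟩
      rw [Finset.mem_Icc] at hi
      exact h3 i hi.1 (by omega)
    · rintro ⟨⟨h1, h2⟩, h3⟩
      refine ⟨fun j => ⟨h1 j, h2 rfl j⟩, fun j hj => ?_, fun i hi hi' =>
        h3 i (Finset.mem_Icc.2 (by omega))⟩
      have := h1 j
      have := hv j
      omega
  · rw [levels, mem_outcomes_reverse]
    constructor
    · rintro ⟨h1, h2, h3⟩
      exact ⟨⟨h1, fun h => nomatch h⟩, fun i hi => h3 i (Finset.mem_Icc.1 hi).1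
        (Finset.mem_Icc.1 hi).2⟩
    · rintro ⟨⟨h1, -⟩, h3⟩
      exact ⟨h1, fun j hj => absurd (hv j) (by omega), fun i hi hi' =>
        h3 i (Finset.mem_Icc.2 ⟨hi, hi'⟩)⟩

theorem card_filter_mem_lowered {κ : Kind} {b : ℕ} {v v' : Fin n → ℕ} (h : IsStep κ v v')
    (hv : ∀ j, v j ≤ b) (j : Fin n) :
    ((Finset.Icc 1 b).filter fun i => j ∈ lowered κ v v' i).card = v j - v' j := by
  have h1 := h.1 j
  have h2 := hv j
  cases κ
  · have h3 := h.2 rfl j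
    simp only [lowered, Finset.mem_filter, Finset.mem_univ, true_and]
    by_cases h4 : v' j < v j
    · rw [show v j - v' j = 1 by omega, Finset.card_eq_one]
      refine ⟨v j, ?_⟩
      ext i
      simp only [Finset.mem_filter, Finset.mem_Icc, Finset.mem_singleton]
      omega
    · rw [show v j - v' j = 0 by omega, Finset.card_eq_zero, Finset.filter_eq_empty_iff]
      intro i _
      omega
  · rw [← Nat.card_Ioc]
    congr 1
    ext i
    simp only [lowered, Finset.mem_filter, Finset.mem_univ, true_and, Finset.mem_Icc,
      Finset.mem_Ioc]
    omega

/-- Double counting of pairs of a column and a level at which it is lowered: column `j` occurs `v j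
- v' j` times. -/
theorem sum_card_lowered {κ : Kind} {b : ℕ} {v v' : Fin n → ℕ} (h : IsStep κ v v')
    (hv : ∀ j, v j ≤ b) :
    ∑ j, v j = ∑ j, v' j + ∑ i ∈ Finset.Icc 1 b, (lowered κ v v' i).card := by
  have h1 := Finset.sum_card_bipartiteAbove_eq_sum_card_bipartiteBelow
    (fun (j : Fin n) i => j ∈ lowered κ v v' i) (s := Finset.univ) (t := Finset.Icc 1 b)
  simp only [Finset.bipartiteAbove, Finset.bipartiteBelow, Finset.filter_univ_mem] at h1
  rw [← h1, ← Finset.sum_add_distrib]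
  refine Finset.sum_congr rfl fun j _ => ?_
  rw [card_filter_mem_lowered h hv]
  have := h.1 j
  omega

open Classical in
/-- The vectors of column sums that are left after removing a row with sum `k`. -/
noncomputable def steps (κ : Kind) (b k : ℕ) (v : Fin n → ℕ) : Finset (Fin n → ℕ) :=
  (childVectors κ b k (countVec v)).biUnion fun s => outcomes s (levels κ b) v

theorem exists_childVector {κ : Kind} {b k : ℕ} {v v' : Fin n → ℕ} (hv : ∀ j, v j ≤ b)
    (h : IsStep κ v v') (hk : ∑ j, v j = ∑ j, v' j + k) :
    ∃ s ∈ childVectors κ b k (countVec v), v' ∈ outcomes s (levels κ b) v := by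
  classical
  refine ⟨Finsupp.indicator (Finset.Icc 1 b) fun i _ => (lowered κ v v' i).card, ?_, ?_⟩
  · have hsum := sum_card_lowered h hv
    have hanti : Finsupp.indicator (Finset.Icc 1 b) (fun i _ => (lowered κ v v' i).card) ∈
        Finset.finsuppAntidiag (Finset.Icc 1 b) k := by
      refine Finset.mem_finsuppAntidiag.2 ⟨?_, Finsupp.support_indicator_subset _ _⟩
      have h1 := Finset.sum_congr rfl fun i (hi : i ∈ Finset.Icc 1 b) =>
        Finsupp.indicator_of_mem hi fun i _ => (lowered κ v v' i).card
      exact h1.trans (by omega)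
    cases κ
    · refine mem_childVectors_binary.2 ⟨hanti, fun i hi => ?_⟩
      rw [Finsupp.indicator_of_mem hi]
      exact Finset.card_le_card fun j hj => by
        simp only [lowered, Finset.mem_filter] at hj ⊢
        exact ⟨hj.1, hj.2.1⟩
    · refine mem_childVectors_natural.2 ⟨hanti, fun i hi => ?_⟩
      rw [Finsupp.indicator_of_mem hi]
      -- A column lowered from `i` either starts there or has just come from `i + 1`; this is the
      -- constraint `s i ≤ w i + s (i + 1)`.
      have h1 : lowered .natural v v' i ⊆ level v i ∪ lowered .natural v v' (i + 1) := by
        intro j hj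
        simp only [lowered, level, Finset.mem_union, Finset.mem_filter, Finset.mem_univ,
          true_and] at hj ⊢
        omega
      refine (Finset.card_le_card h1).trans ((Finset.card_union_le _ _).trans ?_)
      rw [card_level]
      by_cases hi' : i + 1 ∈ Finset.Icc 1 b
      · rw [Finsupp.indicator_of_mem hi']
      · have h2 : lowered .natural v v' (i + 1) = ∅ := by
          refine Finset.filter_eq_empty_iff.2 fun j _ => ?_
          have := hv j
          rw [Finset.mem_Icc] at hi'
          omega
        simp [h2]
  · refine (mem_outcomes_levels hv).2 ⟨h, fun i hi => ?_⟩
    rw [Finsupp.indicator_of_mem hi]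

theorem isStep_of_mem_outcomes {κ : Kind} {b k : ℕ} {v v' : Fin n → ℕ} {w : ℕ → ℕ}
    {s : ℕ →₀ ℕ} (hv : ∀ j, v j ≤ b) (hs : s ∈ childVectors κ b k w)
    (h : v' ∈ outcomes s (levels κ b) v) : IsStep κ v v' ∧ ∑ j, v j = ∑ j, v' j + k := by
  obtain ⟨h1, h2⟩ := (mem_outcomes_levels hv).1 h
  refine ⟨h1, ?_⟩
  rw [sum_card_lowered h1 hv, Finset.sum_congr rfl h2, sum_of_mem_childVectors hs]

theorem mem_steps {κ : Kind} {b k : ℕ} {v v' : Fin n → ℕ} (hv : ∀ j, v j ≤ b) :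
    v' ∈ steps κ b k v ↔ IsStep κ v v' ∧ ∑ j, v j = ∑ j, v' j + k := by
  rw [steps, Finset.mem_biUnion]
  constructor
  · rintro ⟨s, hs, h⟩
    exact isStep_of_mem_outcomes hv hs h
  · rintro ⟨h, hk⟩
    exact exists_childVector hv h hk

/-- The classes are disjoint because `s i` is the number of columns lowered from `i`, which `v` and
`v'` determine. -/
theorem sum_steps {κ : Kind} {b k : ℕ} {v : Fin n → ℕ} (hv : ∀ j, v j ≤ b)
    (f : (Fin n → ℕ) → ℕ) : ∑ v' ∈ steps κ b k v, f v' =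
      ∑ s ∈ childVectors κ b k (countVec v), ∑ v' ∈ outcomes s (levels κ b) v, f v' := by
  classical
  refine Finset.sum_biUnion fun s hs t ht hst => Finset.disjoint_left.2 fun v' h h' => hst ?_
  have h1 := ((mem_outcomes_levels hv).1 h).2
  have h2 := ((mem_outcomes_levels hv).1 h').2
  ext i
  by_cases hi : i ∈ Finset.Icc 1 b
  · rw [← h1 i hi, h2 i hi]
  · have h3 := (Finset.mem_finsuppAntidiag.1 (support_of_mem_childVectors hs)).2
    have h4 := (Finset.mem_finsuppAntidiag.1 (support_of_mem_childVectors ht)).2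
    rw [Finsupp.notMem_support_iff.1 fun h => hi (h3 h),
      Finsupp.notMem_support_iff.1 fun h => hi (h4 h)]

end Steps

/-! ### Counting matrices -/

section Counting

variable {n : ℕ}

theorem finite_tables (κ : Kind) {m : ℕ} (p : Fin m → ℕ) (q : Fin n → ℕ) :
    (tables κ p q).Finite := by
  refine (Set.finite_Iic (fun (i : Fin m) (_ : Fin n) => p i)).subset ?_
  rintro X ⟨-, hX, -⟩ i j
  show X i j ≤ p i
  rw [← hX i]
  exact Finset.single_le_sum (f := fun j => X i j) (fun _ _ => Nat.zero_le _) (Finset.mem_univ j)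

/-- Removing the first row of a matrix leaves a matrix with the remaining margins. -/
theorem tail_mem_tables {κ : Kind} {m : ℕ} {p : Fin (m + 1) → ℕ} {v : Fin n → ℕ}
    {X : Matrix (Fin (m + 1)) (Fin n) ℕ} (hX : X ∈ tables κ p v) :
    (Matrix.of fun i j => X i.succ j) ∈ tables κ (fun i => p i.succ) (fun j => v j - X 0 j) ∧
      IsStep κ v (fun j => v j - X 0 j) ∧ (∀ j, X 0 j ≤ v j) ∧
      ∑ j, v j = ∑ j, (v j - X 0 j) + p 0 := by
  obtain ⟨h1, h2, h3⟩ := hX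
  have h4 : ∀ j, v j = X 0 j + ∑ i : Fin m, X i.succ j := fun j => by
    rw [← h3 j, Fin.sum_univ_succ]
  have h5 : ∀ j, X 0 j ≤ v j := fun j => by rw [h4 j]; omega
  refine ⟨⟨fun hκ i j => h1 hκ _ j, fun i => h2 _, fun j => ?_⟩, ⟨fun j => Nat.sub_le _ _,
    fun hκ j => ?_⟩, h5, ?_⟩
  · simp only [Matrix.of_apply]
    have := h4 j
    omega
  · have := h1 hκ 0 j
    have := h5 j
    show v j ≤ v j - X 0 j + 1
    omega
  · rw [← h2 0, ← Finset.sum_add_distrib]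
    exact Finset.sum_congr rfl fun j _ => (Nat.sub_add_cancel (h5 j)).symm

/-- Put a row on top of a matrix. -/
def consRow {m : ℕ} (r : Fin n → ℕ) (Y : Matrix (Fin m) (Fin n) ℕ) :
    Matrix (Fin (m + 1)) (Fin n) ℕ :=
  Matrix.of fun i j => Fin.cases (r j) (fun i => Y i j) i

theorem consRow_zero {m : ℕ} (r : Fin n → ℕ) (Y : Matrix (Fin m) (Fin n) ℕ) (j : Fin n) :
    consRow r Y 0 j = r j := rfl

theorem consRow_succ {m : ℕ} (r : Fin n → ℕ) (Y : Matrix (Fin m) (Fin n) ℕ) (i : Fin m)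
    (j : Fin n) : consRow r Y i.succ j = Y i j := rfl

theorem consRow_mem_tables {κ : Kind} {m : ℕ} {p : Fin (m + 1) → ℕ} {v v' : Fin n → ℕ}
    (h : IsStep κ v v') (hs : ∑ j, v j = ∑ j, v' j + p 0) {Y : Matrix (Fin m) (Fin n) ℕ}
    (hY : Y ∈ tables κ (fun i => p i.succ) v') :
    consRow (fun j => v j - v' j) Y ∈ tables κ p v := by
  obtain ⟨h1, h2, h3⟩ := hY
  refine ⟨fun hκ i j => ?_, fun i => ?_, fun j => ?_⟩
  · refine Fin.cases ?_ (fun i => ?_) i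
    · have := h.2 hκ j
      rw [consRow_zero]
      omega
    · rw [consRow_succ]; exact h1 hκ i j
  · refine Fin.cases ?_ (fun i => ?_) i
    · simp only [consRow_zero]
      have h5 : ∑ j, v j = ∑ j, v' j + ∑ j, (v j - v' j) := by
        rw [← Finset.sum_add_distrib]
        exact Finset.sum_congr rfl fun j _ => (Nat.add_sub_cancel' (h.1 j)).symm
      omega
    · simp only [consRow_succ]; exact h2 i
  · rw [Fin.sum_univ_succ]
    simp only [consRow_zero, consRow_succ]
    rw [h3 j]
    exact Nat.sub_add_cancel (h.1 j)

/-- A matrix corresponds to the column sums `v'` left after its first row, together with the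
remaining rows; the first row is `v - v'`. -/
theorem ncard_tables_succ {κ : Kind} {m b : ℕ} (p : Fin (m + 1) → ℕ) {v : Fin n → ℕ}
    (hv : ∀ j, v j ≤ b) : (tables κ p v).ncard =
      ∑ v' ∈ steps κ b (p 0) v, (tables κ (fun i => p i.succ) v').ncard := by
  have hfin := fun v' : Fin n → ℕ => (finite_tables κ (fun i => p i.succ) v').to_subtype
  let f : (Σ v' : steps κ b (p 0) v, tables κ (fun i => p i.succ) v'.1) → tables κ p v :=
    fun z => ⟨_, consRow_mem_tables ((mem_steps hv).1 z.1.2).1 ((mem_steps hv).1 z.1.2).2 z.2.2⟩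
  have hf : Function.Bijective f := by
    constructor
    · rintro ⟨⟨v', hv'⟩, Y, hY⟩ ⟨⟨v'', hv''⟩, Z, hZ⟩ h
      have h1 : consRow (fun j => v j - v' j) Y = consRow (fun j => v j - v'' j) Z :=
        congrArg Subtype.val h
      have h3 : Y = Z := by
        ext i j
        exact congrFun (congrFun h1 i.succ) j
      have h4 : v' = v'' := by
        funext j
        have : v j - v' j = v j - v'' j := congrFun (congrFun h1 0) j
        have := ((mem_steps hv).1 hv').1.1 j
        have := ((mem_steps hv).1 hv'').1.1 j
        omega
      subst h4 h3
      rfl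
    · rintro ⟨X, hX⟩
      obtain ⟨h1, h2, h3, h4⟩ := tail_mem_tables hX
      refine ⟨⟨⟨_, (mem_steps hv).2 ⟨h2, h4⟩⟩, _, h1⟩, Subtype.ext ?_⟩
      ext i j
      refine Fin.cases ?_ (fun i => ?_) i
      · have := h3 j
        show v j - (v j - X 0 j) = X 0 j
        omega
      · rfl
  rw [← Nat.card_coe_set_eq, ← Nat.card_congr (Equiv.ofBijective f hf), Nat.card_sigma]
  simp only [Nat.card_coe_set_eq]
  exact Finset.sum_coe_sort _ fun v' => (tables κ (fun i => p i.succ) v').ncard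

theorem ncard_tables_comp_equiv (κ : Kind) {m : ℕ} (p : Fin m → ℕ) (v : Fin n → ℕ)
    (e : Equiv.Perm (Fin n)) : (tables κ p (v ∘ e)).ncard = (tables κ p v).ncard := by
  refine Set.ncard_congr (fun X _ => X.submatrix id e.symm) ?_ ?_ ?_
  · rintro X ⟨h1, h2, h3⟩
    refine ⟨fun hκ i j => h1 hκ _ _, fun i => ?_, fun j => ?_⟩
    · rw [← h2 i]
      exact Equiv.sum_comp e.symm fun j => X i j
    · have := h3 (e.symm j)
      simpa using this
  · intro X Y _ _ h
    ext i j
    have := congrFun (congrFun h i) (e j)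
    simpa using this
  · rintro X ⟨h1, h2, h3⟩
    refine ⟨X.submatrix id e, ⟨fun hκ i j => h1 hκ _ _, fun i => ?_, fun j => h3 (e j)⟩, ?_⟩
    · rw [← h2 i]
      exact Equiv.sum_comp e fun j => X i j
    · ext i j; simp

/-- Both vectors have `n` entries, so agreement on positive values forces equally many zeros.
Bijections between the fibres then glue to a permutation. -/
theorem exists_perm_of_countVec_eq {v v' : Fin n → ℕ}
    (h : ∀ i, 1 ≤ i → countVec v i = countVec v' i) : ∃ e : Equiv.Perm (Fin n), v = v' ∘ e := by
  have key : ∀ u : Fin n → ℕ,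
      countVec u 0 + (Finset.univ.filter fun j => u j ≠ 0).card = n := fun u => by
    rw [countVec, Finset.card_filter_add_card_filter_not, Finset.card_univ, Fintype.card_fin]
  have hne : ∀ u : Fin n → ℕ, ∀ N, (∀ j, u j ≤ N) →
      (Finset.univ.filter fun j => u j ≠ 0).card = ∑ i ∈ Finset.Icc 1 N, countVec u i := by
    intro u N hN
    rw [Finset.card_eq_sum_card_fiberwise (f := u) (t := Finset.Icc 1 N)]
    · refine Finset.sum_congr rfl fun i hi => ?_
      rw [Finset.filter_filter, countVec]
      congr 1
      refine Finset.filter_congr fun j _ => ?_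
      rw [Finset.mem_Icc] at hi
      omega
    · intro j hj
      have := hN j
      simp at hj ⊢
      omega
  have h0 : ∀ i, countVec v i = countVec v' i := by
    intro i
    rcases Nat.eq_zero_or_pos i with rfl | hi
    · have h1 := key v
      have h2 := key v'
      rw [hne v (Finset.univ.sup v + Finset.univ.sup v') fun j =>
        (Finset.le_sup (Finset.mem_univ j)).trans (Nat.le_add_right _ _)] at h1
      rw [hne v' (Finset.univ.sup v + Finset.univ.sup v') fun j =>
        (Finset.le_sup (Finset.mem_univ j)).trans (Nat.le_add_left _ _)] at h2
      have h3 : ∑ i ∈ Finset.Icc 1 (Finset.univ.sup v + Finset.univ.sup v'), countVec v i =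
          ∑ i ∈ Finset.Icc 1 (Finset.univ.sup v + Finset.univ.sup v'), countVec v' i :=
        Finset.sum_congr rfl fun i hi => h i (Finset.mem_Icc.1 hi).1
      omega
    · exact h i hi
  have e : ∀ i, Nonempty ({j // v j = i} ≃ {j // v' j = i}) := fun i => by
    refine Fintype.card_eq.1 ?_
    rw [Fintype.card_subtype, Fintype.card_subtype]
    exact h0 i
  refine ⟨Equiv.ofFiberEquiv fun i => (e i).some, ?_⟩
  funext j
  exact (Equiv.ofFiberEquiv_map _ j).symm

theorem ncard_tables_get_ofFn (κ : Kind) {m : ℕ} (p : Fin m → ℕ) (v : Fin n → ℕ) :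
    (tables κ (List.ofFn p).get v).ncard = (tables κ p v).ncard := by
  have key : ∀ (u : List ℕ) (m : ℕ) (h : u.length = m) (p : Fin m → ℕ),
      (∀ i, p i = u.get (Fin.cast h.symm i)) →
      (tables κ u.get v).ncard = (tables κ p v).ncard := by
    rintro u m rfl p hp
    rw [show p = u.get from funext hp]
  exact key _ m (List.length_ofFn) p fun i => by simp

/-- The representative chosen in `nodeCount` is a permutation of `v`, and permuting columns
preserves the number of matrices. -/
theorem nodeCount_ofFn (κ : Kind) {m : ℕ} (p : Fin m → ℕ) {v : Fin n → ℕ} {w : ℕ → ℕ}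
    (h : ∀ i, 1 ≤ i → countVec v i = w i) :
    nodeCount κ n (List.ofFn p) w = (tables κ p v).ncard := by
  have hex : ∃ v : Fin n → ℕ, ∀ i, 1 ≤ i → countVec v i = w i := ⟨v, h⟩
  rw [nodeCount, dif_pos hex, ncard_tables_get_ofFn]
  obtain ⟨e, he⟩ := exists_perm_of_countVec_eq fun i hi => (hex.choose_spec i hi).trans (h i hi).symm
  rw [he, ncard_tables_comp_equiv]

theorem rowCount_congr {κ : Kind} {b : ℕ} {w w' : ℕ → ℕ} (h : ∀ i, 1 ≤ i → w i = w' i)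
    (s : ℕ →₀ ℕ) : rowCount κ b w s = rowCount κ b w' s := by
  cases κ
  all_goals
    refine Finset.prod_congr rfl fun i hi => ?_
    rw [h i (Finset.mem_Icc.1 hi).1]

theorem nodeCount_child {κ : Kind} {m b k : ℕ} (p : Fin m → ℕ) {v v' : Fin n → ℕ} {w : ℕ → ℕ}
    {s : ℕ →₀ ℕ} (hw : ∀ i, 1 ≤ i → countVec v i = w i) (hs : s ∈ childVectors κ b k w)
    (h : v' ∈ outcomes s (levels κ b) v) :
    nodeCount κ n (List.ofFn p) (reduce w s) = (tables κ p v').ncard := by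
  refine nodeCount_ofFn κ p fun i hi => ?_
  rw [countVec_of_mem_outcomes (fun i hi => (mem_levels.1 hi).1) h,
    finalCounts_levels ((childVectors_congr hw) ▸ hs) hi, reduce, reduce, hw i hi]

/-- The recursion for the counts. -/
theorem nodeCount_succ {κ : Kind} {m b : ℕ} (p : Fin (m + 1) → ℕ) {v : Fin n → ℕ} {w : ℕ → ℕ}
    (hw : ∀ i, 1 ≤ i → countVec v i = w i) (hv : ∀ j, v j ≤ b) :
    nodeCount κ n (List.ofFn p) w = ∑ s ∈ childVectors κ b (p 0) w,
      rowCount κ b w s * nodeCount κ n (List.ofFn fun i => p i.succ) (reduce w s) := by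
  rw [nodeCount_ofFn κ p hw, ncard_tables_succ p hv, sum_steps hv, childVectors_congr hw]
  refine Finset.sum_congr rfl fun s hs => ?_
  rw [Finset.sum_congr rfl fun v' hv' => (nodeCount_child (fun i => p i.succ) hw hs hv').symm,
    Finset.sum_const, smul_eq_mul, card_outcomes s (nodup_levels κ b)
      (fun i hi => (mem_levels.1 hi).1), pathCount_levels hs, rowCount_congr hw]

theorem exists_card_fiber_eq {ι T : Type} [Fintype ι] [DecidableEq ι] [Fintype T] {r : ι → ℕ}
    (h : ∑ j, r j = Fintype.card T) :
    ∃ f : T → ι, ∀ j, (Finset.univ.filter fun t => f t = j).card = r j := by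
  obtain ⟨e⟩ : Nonempty (T ≃ Σ j, Fin (r j)) := Fintype.card_eq.1 (by simp [h])
  refine ⟨fun t => (e t).1, fun j => ?_⟩
  rw [← Fintype.card_subtype,
    Fintype.card_congr ((e.subtypeEquiv fun t => Iff.rfl).trans (Equiv.sigmaSubtype j)),
    Fintype.card_fin]

/-- Distribute the `p i` units of row `i` among the columns with nonzero sum: every matrix arises
from such a map, by counting its fibres. -/
theorem ncard_tables_le (κ : Kind) {m : ℕ} (p : Fin m → ℕ) (v : Fin n → ℕ) :
    (tables κ p v).ncard ≤ (Finset.univ.filter fun j => v j ≠ 0).card ^ ∑ i, p i := by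
  classical
  let A := {j : Fin n // v j ≠ 0}
  let F : ((Σ i, Fin (p i)) → A) → Matrix (Fin m) (Fin n) ℕ := fun f =>
    Matrix.of fun i j => (Finset.univ.filter fun t : Fin (p i) => (f ⟨i, t⟩ : Fin n) = j).card
  have hF : tables κ p v ⊆ Set.range F := by
    rintro X ⟨-, h2, h3⟩
    have hX : ∀ i j, X i j ≠ 0 → v j ≠ 0 := by
      intro i j hij hj
      rw [← h3 j, Finset.sum_eq_zero_iff] at hj
      exact hij (hj i (Finset.mem_univ i))
    choose f hf using fun i => exists_card_fiber_eq (T := Fin (p i)) (r := X i) (by simp [h2 i])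
    refine ⟨fun z => ⟨f z.1 z.2, hX z.1 _ ?_⟩, ?_⟩
    · rw [← hf, Finset.card_ne_zero]
      exact ⟨z.2, by simp⟩
    · ext i j
      exact hf i j
  refine (Set.ncard_le_ncard hF (Set.finite_range F)).trans ?_
  rw [← Set.image_univ]
  refine (Set.ncard_image_le Set.finite_univ).trans (le_of_eq ?_)
  rw [Set.ncard_univ, Nat.card_eq_fintype_card, Fintype.card_fun, Fintype.card_subtype,
    Fintype.card_sigma]
  simp

/-- Distribute the units of all the rows among the columns so that column `j` receives `q j` of
them. -/
theorem nonempty_tables_natural {m : ℕ} {p : Fin m → ℕ} {q : Fin n → ℕ}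
    (h : ∑ i, p i = ∑ j, q j) : (tables .natural p q).Nonempty := by
  classical
  obtain ⟨f, hf⟩ := exists_card_fiber_eq (T := Σ i, Fin (p i)) (r := q) (by simp [h])
  refine ⟨Matrix.of fun i j => (Finset.univ.filter fun t : Fin (p i) => f ⟨i, t⟩ = j).card,
    fun h => Kind.noConfusion h, fun i => ?_, fun j => ?_⟩
  · simp only [Matrix.of_apply]
    rw [← Finset.card_eq_sum_card_fiberwise fun _ _ => Finset.mem_coe.2 (Finset.mem_univ _)]
    simp
  · rw [← hf j]
    simp only [Matrix.of_apply, Finset.card_filter, Fintype.sum_sigma]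

end Counting

/-! ### The search tree -/

section Search

variable {α : Type}

theorem sum_take_add_sum_drop (l : List (α × ℕ)) (k : ℕ) :
    ((l.take k).map Prod.snd).sum + ((l.drop k).map Prod.snd).sum = (l.map Prod.snd).sum := by
  rw [← List.sum_append, ← List.map_append, List.take_append_drop]

theorem SearchTree.search_leaf (a : α) (x : ℕ) :
    (SearchTree.leaf a).search x = tick 1 >>= fun _ => pure a := rfl

theorem SearchTree.search_node (key : ℕ) (t t' : SearchTree α) (x : ℕ) :
    (SearchTree.node key t t').search x =
      tick 2 >>= fun _ => if x ≤ key then t.search x else t'.search (x - key) := rfl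

variable [Inhabited α]

theorem SearchTree.induction_build {P : List (α × ℕ) → SearchTree α → Prop}
    (nil : P [] (.leaf default)) (single : ∀ x : α × ℕ, P [x] (.leaf x.1))
    (node : ∀ (l : List (α × ℕ)) (k : ℕ), 2 ≤ l.length → k = l.length / 2 →
      P (l.take k) (.build (l.take k)) → P (l.drop k) (.build (l.drop k)) →
      P l (.node ((l.take k).map Prod.snd).sum (.build (l.take k)) (.build (l.drop k))))
    (l : List (α × ℕ)) : P l (.build l) := by
  induction h : l.length using Nat.strong_induction_on generalizing l with
  | _ N ih =>
    match l with
    | [] => rw [build]; exact nil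
    | [x] => rw [build]; exact single x
    | x :: y :: l =>
      rw [build]
      simp only [List.length_cons] at h
      refine node (x :: y :: l) ((l.length + 2) / 2) (by simp) (by simp only [List.length_cons]) ?_ ?_
      · exact ih _ (by simp; omega) _ rfl
      · exact ih _ (by simp; omega) _ rfl

/-- As the number searched runs through `1, …, total weight`, each item is found as often as its
weight says; the key splits this range between the two subtrees. -/
theorem expect_search (h : α → ℝ≥0∞) (l : List (α × ℕ)) :
    ∑ x ∈ Finset.range (l.map Prod.snd).sum, expect ((SearchTree.build l).search (x + 1)) h =
      (l.map fun y => (y.2 : ℝ≥0∞) * h y.1).sum := by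
  refine SearchTree.induction_build (P := fun l t =>
    ∑ x ∈ Finset.range (l.map Prod.snd).sum, expect (t.search (x + 1)) h =
      (l.map fun y => (y.2 : ℝ≥0∞) * h y.1).sum) ?_ ?_ ?_ l
  · simp
  · intro x
    simp [SearchTree.search_leaf, expect_bind, expect_tick, expect_pure]
  · intro l k _ _ h1 h2
    rw [← sum_take_add_sum_drop l k, Finset.sum_range_add]
    conv_rhs => rw [← List.take_append_drop k l, List.map_append, List.sum_append]
    rw [← h1, ← h2]
    congr 1
    · refine Finset.sum_congr rfl fun x hx => ?_
      rw [Finset.mem_range] at hx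
      rw [SearchTree.search_node, expect_bind, expect_tick, if_pos (by omega)]
    · refine Finset.sum_congr rfl fun x hx => ?_
      rw [SearchTree.search_node, expect_bind, expect_tick, if_neg (by omega)]
      congr 2
      omega

theorem ensures_search (l : List (α × ℕ)) : ∀ x, 1 ≤ x → x ≤ (l.map Prod.snd).sum →
    ((SearchTree.build l).search x).Ensures fun a => ∃ w, 1 ≤ w ∧ (a, w) ∈ l := by
  refine SearchTree.induction_build (P := fun l t => ∀ x, 1 ≤ x → x ≤ (l.map Prod.snd).sum →
    (t.search x).Ensures fun a => ∃ w, 1 ≤ w ∧ (a, w) ∈ l) ?_ ?_ ?_ l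
  · intro x hx hx'
    simp at hx'
    omega
  · intro y x hx hx'
    simp at hx'
    exact Ensures.tick_bind (ensures_pure ⟨y.2, by omega, by simp⟩)
  · intro l k _ _ h1 h2 x hx hx'
    rw [← sum_take_add_sum_drop l k] at hx'
    rw [SearchTree.search_node]
    refine Ensures.tick_bind ?_
    split_ifs with h
    · exact (h1 x hx h).mono fun a ⟨w, hw, ha⟩ => ⟨w, hw, List.mem_of_mem_take ha⟩
    · exact (h2 (x - _) (by omega) (by omega)).mono
        fun a ⟨w, hw, ha⟩ => ⟨w, hw, List.mem_of_mem_drop ha⟩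

theorem expectedTime_search_le (l : List (α × ℕ)) : ∀ x,
    ((SearchTree.build l).search x).expectedTime ≤ ((2 * Nat.clog 2 l.length + 1 : ℕ) : ℝ≥0∞) := by
  refine SearchTree.induction_build (P := fun l t => ∀ x,
    (t.search x).expectedTime ≤ ((2 * Nat.clog 2 l.length + 1 : ℕ) : ℝ≥0∞)) ?_ ?_ ?_ l
  · intro x
    simp [SearchTree.search_leaf, expectedTime_tick_bind, expectedTime_pure]
  · intro y x
    simp [SearchTree.search_leaf, expectedTime_tick_bind, expectedTime_pure]
  · intro l k hl hk h1 h2 x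
    rw [SearchTree.search_node, expectedTime_tick_bind, Nat.clog_of_two_le one_lt_two hl]
    -- Both halves have at most half the length rounded up, which lowers `Nat.clog 2` by one and
    -- pays for the two operations.
    have key : ∀ N, N ≤ (l.length + 2 - 1) / 2 →
        ((2 : ℕ) : ℝ≥0∞) + ((2 * Nat.clog 2 N + 1 : ℕ) : ℝ≥0∞) ≤
          ((2 * (Nat.clog 2 ((l.length + 2 - 1) / 2) + 1) + 1 : ℕ) : ℝ≥0∞) := by
      intro N hN
      have := Nat.clog_mono_right 2 hN
      exact_mod_cast (by omega : 2 + (2 * Nat.clog 2 N + 1) ≤ _)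
    split_ifs with h
    · refine (add_le_add_right (h1 x) _).trans (key _ ?_)
      rw [List.length_take]; omega
    · refine (add_le_add_right (h2 _) _).trans (key _ ?_)
      rw [List.length_drop]; omega

end Search

theorem card_childVectors_le (κ : Kind) (b k : ℕ) (w : ℕ → ℕ) :
    (childVectors κ b k w).card ≤ (k + 1) ^ b := by
  classical
  have h : (childVectors κ b k w).card ≤
      (Fintype.piFinset fun _ : Fin b => Finset.range (k + 1)).card := by
    refine Finset.card_le_card_of_injOn (fun s i => s (i + 1)) ?_ ?_
    · intro s hs
      rw [Finset.mem_coe] at hs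
      refine Finset.mem_coe.2 (Fintype.mem_piFinset.2 fun i => Finset.mem_range.2 ?_)
      rw [Nat.lt_succ_iff, ← sum_of_mem_childVectors hs]
      exact Finset.single_le_sum (f := s) (fun _ _ => Nat.zero_le _)
        (Finset.mem_Icc.2 (by omega))
    · intro s hs t ht hst
      rw [Finset.mem_coe] at hs ht
      ext i
      by_cases hi : 1 ≤ i ∧ i ≤ b
      · have := congrFun hst ⟨i - 1, by omega⟩
        simpa [Nat.sub_add_cancel hi.1] using this
      · have h3 := (Finset.mem_finsuppAntidiag.1 (support_of_mem_childVectors hs)).2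
        have h4 := (Finset.mem_finsuppAntidiag.1 (support_of_mem_childVectors ht)).2
        rw [Finsupp.notMem_support_iff.1 fun h => hi (Finset.mem_Icc.1 (h3 h)),
          Finsupp.notMem_support_iff.1 fun h => hi (Finset.mem_Icc.1 (h4 h))]
  simpa using h

/-! ### Sampling without replacement -/

section Columns

variable {n : ℕ} (G : UniformGenerator)

theorem swapRemove_perm {α : Type} {l : List α} {i : ℕ} {a : α} (h : l[i]? = some a) :
    (a :: swapRemove l i).Perm l := by
  classical
  rcases List.eq_nil_or_concat l with rfl | ⟨l, z, rfl⟩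
  · simp at h
  · obtain ⟨hi, h⟩ := List.getElem?_eq_some_iff.1 h
    simp only [List.concat_eq_append, List.length_append, List.length_singleton] at hi h ⊢
    rw [swapRemove, List.getLast?_append_of_ne_nil _ (by simp)]
    simp only [List.getLast?_singleton]
    -- Either an inner entry is replaced by the last one, or the last entry overwrites itself and is
    -- dropped.
    rcases Nat.lt_succ_iff_lt_or_eq.1 hi with hi' | rfl
    · rw [List.set_append_left _ _ hi', List.dropLast_concat]
      rw [List.getElem_append_left hi'] at h
      rw [List.set_eq_take_append_cons_drop, if_pos hi']
      conv_rhs => rw [← List.take_append_drop i l, List.drop_eq_getElem_cons hi', h]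
      rw [List.perm_iff_count]
      intro c
      simp only [List.count_cons, List.count_append, List.count_nil]
      omega
    · rw [List.set_append_right _ _ le_rfl]
      simp only [List.getElem_concat_length] at h
      subst h
      simpa using (List.perm_append_singleton z l).symm

theorem takeColumns_zero (l : List (Fin n)) :
    takeColumns G 0 l = tick 1 >>= fun _ => pure (l, []) := rfl

theorem takeColumns_succ (k : ℕ) (l : List (Fin n)) :
    takeColumns G (k + 1) l = G.draw l.length >>= fun x => tick 4 >>= fun _ =>
      match l[x - 1]? with
      | none => pure (l, [])
      | some j => takeColumns G k (swapRemove l (x - 1)) >>= fun r => pure (r.1, j :: r.2) := rfl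

theorem length_swapRemove {α : Type} {l : List α} {i : ℕ} {a : α} (h : l[i]? = some a) :
    (swapRemove l i).length + 1 = l.length := by
  rw [← (swapRemove_perm h).length_eq, List.length_cons]

theorem exists_getElem? {α : Type} {l : List α} {x : ℕ} (h : 1 ≤ x ∧ x ≤ l.length) :
    ∃ a, l[x - 1]? = some a :=
  ⟨_, List.getElem?_eq_getElem (by omega : x - 1 < l.length)⟩

theorem ensures_takeColumns {k : ℕ} {l : List (Fin n)} (hk : k ≤ l.length) :
    (takeColumns G k l).Ensures fun r => (r.1 ++ r.2).Perm l ∧ r.2.length = k := by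
  induction k generalizing l with
  | zero => exact Ensures.tick_bind (ensures_pure (by simp))
  | succ k ih =>
    rw [takeColumns_succ]
    refine (G.ensures_draw (by omega)).bind fun x hx => Ensures.tick_bind ?_
    obtain ⟨j, hj⟩ := exists_getElem? hx
    have := length_swapRemove hj
    simp only [hj]
    refine (ih (by omega)).bind fun r hr => ensures_pure ⟨?_, by simp [hr.2]⟩
    exact List.perm_middle.trans ((hr.1.cons j).trans (swapRemove_perm hj))

theorem expectedTime_takeColumns_le {k N : ℕ} {l : List (Fin n)} (hk : k ≤ l.length)
    (hN : l.length ≤ N) :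
    (takeColumns G k l).expectedTime ≤ k * (G.Tr N + 4) + 1 := by
  induction k generalizing l with
  | zero => simp [takeColumns_zero, expectedTime_tick_bind, expectedTime_pure]
  | succ k ih =>
    rw [takeColumns_succ]
    refine (expectedTime_bind_le (t := 4 + (k * (G.Tr N + 4) + 1))
      (G.expectedTime_draw_le (by omega : 1 ≤ l.length) hN)
      (G.ensures_draw (by omega)) fun x hx => ?_).trans (le_of_eq ?_)
    · rw [expectedTime_tick_bind]
      obtain ⟨j, hj⟩ := exists_getElem? hx
      have := length_swapRemove hj
      simp only [hj, Nat.cast_ofNat]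
      gcongr
      refine (expectedTime_bind_le (ih (l := swapRemove l (x - 1)) (by omega) (by omega))
        (ensures_true _) (t := 0) fun r _ => ?_).trans (by simp)
      rw [expectedTime_pure]
    · push_cast; ring

/-- A given `k`-set is chosen with probability at least one over the binomial coefficient: its first
element can be any member of `S`, and the others follow by induction from the shortened array. -/
theorem le_expect_takeColumns {k : ℕ} {l : List (Fin n)} (hl : l.Nodup) {S : Finset (Fin n)}
    (hS : ∀ j ∈ S, j ∈ l) (hk : S.card = k) {c : ℝ≥0∞}
    {g : List (Fin n) × List (Fin n) → ℝ≥0∞}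
    (hg : ∀ r : List (Fin n) × List (Fin n), (r.1 ++ r.2).Perm l → r.2.toFinset = S → c ≤ g r) :
    c ≤ (l.length.choose k : ℝ≥0∞) * expect (takeColumns G k l) g := by
  induction k generalizing l S g with
  | zero =>
    rw [takeColumns_zero, expect_bind, expect_tick, expect_pure, Nat.choose_zero_right,
      Nat.cast_one, one_mul]
    exact hg _ (by simp) (by simpa using (Finset.card_eq_zero.1 hk).symm)
  | succ k ih =>
    have hlen : k + 1 ≤ l.length := by
      rw [← hk, ← List.toFinset_card_of_nodup hl]
      exact Finset.card_le_card fun j hj => List.mem_toFinset.2 (hS j hj)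
    obtain ⟨L, hL⟩ : ∃ L, l.length = L + 1 := ⟨l.length - 1, by omega⟩
    -- The absorption identity: the factor `k + 1` stands for the possible first elements, and
    -- `l.length` cancels the first draw.
    have hchoose : ((k + 1 : ℕ) : ℝ≥0∞) * (l.length.choose (k + 1) : ℝ≥0∞) =
        (L.choose k : ℝ≥0∞) * (l.length : ℝ≥0∞) := by
      rw [hL]
      exact_mod_cast (by rw [mul_comm, ← Nat.add_one_mul_choose_eq, mul_comm])
    have h0 : ((k + 1 : ℕ) : ℝ≥0∞) ≠ 0 := by exact_mod_cast k.succ_ne_zero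
    refine (ENNReal.mul_le_mul_iff_right h0 (ENNReal.natCast_ne_top _)).1 ?_
    rw [← mul_assoc, hchoose, mul_assoc, takeColumns_succ, expect_bind,
      G.mul_expect_draw (by omega), Finset.mul_sum]
    simp only [expect_bind, expect_tick, Nat.add_sub_cancel]
    -- Only the draws that hit a member of `S` are kept.
    have hsub : S.image (fun j => l.idxOf j) ⊆ Finset.range l.length := by
      intro x hx
      obtain ⟨j, hj, rfl⟩ := Finset.mem_image.1 hx
      exact Finset.mem_range.2 (List.idxOf_lt_length_of_mem (hS j hj))
    refine le_trans ?_ (Finset.sum_le_sum_of_subset hsub)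
    rw [Finset.sum_image fun i hi j _ h => (List.idxOf_inj (hS i hi)).1 h, ← hk,
      ← nsmul_eq_mul]
    refine Finset.card_nsmul_le_sum _ _ _ fun j hj => ?_
    have hj' : l[l.idxOf j]? = some j := List.getElem?_idxOf (hS j hj)
    have hperm := swapRemove_perm hj'
    have hlen' : (swapRemove l (l.idxOf j)).length = L := by
      have := length_swapRemove hj'
      omega
    simp only [hj']
    rw [← hlen', expect_bind]
    have hnd := (hperm.nodup_iff.2 hl)
    rw [List.nodup_cons] at hnd
    refine ih hnd.2 (S := S.erase j) (fun i hi => ?_) ?_ fun r hr hrS => ?_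
    · have := hperm.mem_iff.2 (hS i (Finset.mem_of_mem_erase hi))
      exact (List.mem_cons.1 this).resolve_left (Finset.ne_of_mem_erase hi)
    · rw [Finset.card_erase_of_mem hj, hk, Nat.add_sub_cancel]
    · rw [expect_pure]
      refine hg _ (List.perm_middle.trans ((hr.cons j).trans hperm)) ?_
      rw [List.toFinset_cons, hrS, Finset.insert_erase hj]

/-! ### Lowering columns in the buckets -/

/-- The buckets store the column sums `v`. -/
def Stores (B : Buckets n) (v : Fin n → ℕ) : Prop :=
  ∀ i, 1 ≤ i → (B i).Nodup ∧ ∀ j, j ∈ B i ↔ v j = i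

theorem Stores.length {B : Buckets n} {v : Fin n → ℕ} (h : Stores B v) {i : ℕ} (hi : 1 ≤ i) :
    (B i).length = countVec v i := by
  rw [← List.toFinset_card_of_nodup (h i hi).1, countVec]
  congr 1
  ext j
  simp [(h i hi).2 j]

theorem stores_initialBuckets (q : Fin n → ℕ) : Stores (initialBuckets q) q := by
  intro i hi
  rw [initialBuckets, if_neg (by omega)]
  exact ⟨(List.nodup_finRange n).filter _, fun j => by simp⟩

theorem subset_level_of_perm {B : Buckets n} {v : Fin n → ℕ} (h : Stores B v) {i : ℕ}
    (hi : 1 ≤ i) {l r : List (Fin n)} (hp : (l ++ r).Perm (B i)) : r.toFinset ⊆ level v i := by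
  intro j hj
  rw [mem_level, ← (h i hi).2 j, ← hp.mem_iff]
  exact List.mem_append_right _ (List.mem_toFinset.1 hj)

theorem Stores.update {B : Buckets n} {v : Fin n → ℕ} (h : Stores B v) {i : ℕ} (hi : 1 ≤ i)
    {l r : List (Fin n)} (hp : (l ++ r).Perm (B i)) :
    Stores (Function.update (Function.update B i l) (i - 1) (r ++ B (i - 1)))
      (lower v r.toFinset) := by
  have hS := subset_level_of_perm h hi hp
  have hnd := hp.nodup_iff.2 (h i hi).1
  rw [List.nodup_append'] at hnd
  intro k hk
  by_cases hk' : k = i - 1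
  · subst hk'
    rw [Function.update_self]
    refine ⟨List.nodup_append'.2 ⟨hnd.2.1, (h _ hk).1, fun j hj hj' => ?_⟩, fun j => ?_⟩
    · have h1 := mem_level.1 (hS (List.mem_toFinset.2 hj))
      have h2 := ((h _ hk).2 j).1 hj'
      omega
    · rw [← mem_level, level_lower_pred hS, List.mem_append, Finset.mem_union, List.mem_toFinset,
        (h _ hk).2, mem_level]
  · rw [Function.update_of_ne hk']
    by_cases hki : k = i
    · subst hki
      rw [Function.update_self]
      refine ⟨hnd.1, fun j => ?_⟩
      rw [← mem_level, level_lower hi hS, Finset.mem_sdiff, mem_level, ← (h _ hi).2 j,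
        ← hp.mem_iff, List.mem_append, List.mem_toFinset]
      have := @hnd.2.2 j
      tauto
    · rw [Function.update_of_ne hki]
      refine ⟨(h k hk).1, fun j => ?_⟩
      rw [← mem_level, level_lower_of_ne hS hki hk', mem_level, (h k hk).2]

theorem lowerColumns_cons (s : ℕ →₀ ℕ) (i : ℕ) (is : List ℕ) (B : Buckets n) :
    lowerColumns G s (i :: is) B = tick 1 >>= fun _ => takeColumns G (s i) (B i) >>= fun r =>
      tick (2 * r.2.length) >>= fun _ => lowerColumns G s is
        (Function.update (Function.update B i r.1) (i - 1) (r.2 ++ B (i - 1))) >>= fun t =>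
      pure (t.1, r.2 ++ t.2) := rfl

theorem count_add_lower {B : Buckets n} {v : Fin n → ℕ} (h : Stores B v) {i : ℕ} (hi : 1 ≤ i)
    {l r : List (Fin n)} (hp : (l ++ r).Perm (B i)) (j : Fin n) :
    r.count j + lower v r.toFinset j = v j := by
  have hnd := hp.nodup_iff.2 (h i hi).1
  rw [List.nodup_append'] at hnd
  rw [hnd.2.1.count, lower]
  simp only [List.mem_toFinset]
  split_ifs with hj
  · have := mem_level.1 (subset_level_of_perm h hi hp (List.mem_toFinset.2 hj))
    omega
  · omega

theorem pathCount_cons_ne_zero {s : ℕ →₀ ℕ} {i : ℕ} {is : List ℕ} {w : ℕ → ℕ}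
    (h : pathCount s (i :: is) w ≠ 0) :
    s i ≤ w i ∧ pathCount s is (lowerCounts w i (s i)) ≠ 0 := by
  rw [pathCount, mul_ne_zero_iff] at h
  refine ⟨?_, h.2⟩
  by_contra hlt
  exact h.1 (Nat.choose_eq_zero_of_lt (by omega))

/-- A nonzero `pathCount` guarantees enough columns at every level, so no draw fails; the buckets
and the output then stay consistent with the column sums. -/
theorem ensures_lowerColumns {s : ℕ →₀ ℕ} {is : List ℕ} (his : ∀ i ∈ is, 1 ≤ i) {B : Buckets n}
    {v : Fin n → ℕ} (hB : Stores B v) (hc : pathCount s is (countVec v) ≠ 0) :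
    (lowerColumns G s is B).Ensures fun t => ∃ v' ∈ outcomes s is v, Stores t.1 v' ∧
      ∀ j, t.2.count j + v' j = v j := by
  induction is generalizing B v with
  | nil => exact ensures_pure ⟨v, by simp [outcomes], hB, by simp⟩
  | cons i is ih =>
    obtain ⟨h1, h2⟩ := pathCount_cons_ne_zero hc
    have hi := his i List.mem_cons_self
    rw [lowerColumns_cons]
    refine Ensures.tick_bind ((ensures_takeColumns G (by rwa [hB.length hi])).bind fun r hr =>
      Ensures.tick_bind ?_)
    have hS := subset_level_of_perm hB hi hr.1
    have hcard : r.2.toFinset.card = s i := by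
      have hnd := hr.1.nodup_iff.2 (hB i hi).1
      rw [List.nodup_append'] at hnd
      rw [List.toFinset_card_of_nodup hnd.2.1, hr.2]
    refine (ih (fun k hk => his k (List.mem_cons_of_mem _ hk)) (hB.update hi hr.1)
      (by rwa [countVec_lower hi hS, hcard])).bind fun t ⟨v', hv', ht, hcount⟩ => ensures_pure
        ⟨v', mem_outcomes_cons.2 ⟨_, hS, hcard, hv'⟩, ht, fun j => ?_⟩
    rw [List.count_append, add_assoc, hcount, count_add_lower hB hi hr.1]

theorem countVec_le {v : Fin n → ℕ} {i : ℕ} (hi : 1 ≤ i) :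
    countVec v i ≤ (Finset.univ.filter fun j => v j ≠ 0).card := by
  refine Finset.card_le_card fun j hj => ?_
  simp only [Finset.mem_filter] at hj ⊢
  exact ⟨hj.1, by omega⟩

theorem card_ne_zero_mono {v v' : Fin n → ℕ} (h : ∀ j, v' j ≤ v j) :
    (Finset.univ.filter fun j => v' j ≠ 0).card ≤ (Finset.univ.filter fun j => v j ≠ 0).card := by
  refine Finset.card_le_card fun j hj => ?_
  simp only [Finset.mem_filter] at hj ⊢
  have := h j
  exact ⟨hj.1, by omega⟩

/-- A level costs one operation on entry and one when `takeColumns` stops. A chosen column costs its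
draw, four operations for its removal and two for storing it. -/
theorem expectedTime_lowerColumns_le {s : ℕ →₀ ℕ} {is : List ℕ} (his : ∀ i ∈ is, 1 ≤ i)
    {B : Buckets n} {v : Fin n → ℕ} (hB : Stores B v) (hc : pathCount s is (countVec v) ≠ 0)
    {N : ℕ} (hN : (Finset.univ.filter fun j => v j ≠ 0).card ≤ N) :
    (lowerColumns G s is B).expectedTime ≤
      (is.map fun i => 2 + (s i : ℝ≥0∞) * (G.Tr N + 6)).sum := by
  induction is generalizing B v with
  | nil => exact (expectedTime_pure _).le.trans zero_le
  | cons i is ih =>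
    obtain ⟨h1, h2⟩ := pathCount_cons_ne_zero hc
    have hi := his i List.mem_cons_self
    rw [lowerColumns_cons, expectedTime_tick_bind, List.map_cons, List.sum_cons]
    refine (add_le_add_right (expectedTime_bind_le
      (expectedTime_takeColumns_le G (N := N) (by rwa [hB.length hi])
        ((hB.length hi).le.trans ((countVec_le hi).trans hN)))
      (ensures_takeColumns G (by rwa [hB.length hi])) (t := 2 * (s i : ℝ≥0∞) +
        (is.map fun i => 2 + (s i : ℝ≥0∞) * (G.Tr N + 6)).sum) fun r hr => ?_) _).trans
      (le_of_eq (by push_cast; ring))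
    rw [expectedTime_tick_bind, hr.2]
    push_cast
    gcongr
    have hS := subset_level_of_perm hB hi hr.1
    have hcard : r.2.toFinset.card = s i := by
      have hnd := hr.1.nodup_iff.2 (hB i hi).1
      rw [List.nodup_append'] at hnd
      rw [List.toFinset_card_of_nodup hnd.2.1, hr.2]
    refine (expectedTime_bind_le (ih (fun k hk => his k (List.mem_cons_of_mem _ hk))
      (hB.update hi hr.1) (by rwa [countVec_lower hi hS, hcard])
      ((card_ne_zero_mono (lower_le v _)).trans hN)) (ensures_true _) (t := 0)
      fun t _ => ?_).trans (by simp)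
    rw [expectedTime_pure]

theorem le_expect_lowerColumns {s : ℕ →₀ ℕ} {is : List ℕ} (his : ∀ i ∈ is, 1 ≤ i)
    {B : Buckets n} {v v' : Fin n → ℕ} (hB : Stores B v) (hv' : v' ∈ outcomes s is v)
    {c : ℝ≥0∞} {g : Buckets n × List (Fin n) → ℝ≥0∞}
    (hg : ∀ t : Buckets n × List (Fin n), Stores t.1 v' → (∀ j, t.2.count j + v' j = v j) →
      c ≤ g t) :
    c ≤ (pathCount s is (countVec v) : ℝ≥0∞) * expect (lowerColumns G s is B) g := by
  induction is generalizing B v g with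
  | nil =>
    rw [outcomes, Finset.mem_singleton] at hv'
    rw [lowerColumns, expect_pure, pathCount, Nat.cast_one, one_mul]
    exact hg _ (hv' ▸ hB) (by simp [hv'])
  | cons i is ih =>
    obtain ⟨S, hS, hcard, hv'⟩ := mem_outcomes_cons.1 hv'
    have hi := his i List.mem_cons_self
    rw [lowerColumns_cons, expect_bind, expect_tick, expect_bind, pathCount, Nat.cast_mul,
      mul_assoc, ← expect_mul_left, ← hB.length hi]
    refine le_expect_takeColumns G (hB i hi).1
      (fun j hj => ((hB i hi).2 j).2 (mem_level.1 (hS hj))) hcard fun r hr hrS => ?_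
    rw [expect_bind, expect_tick, expect_bind, ← hcard, ← countVec_lower hi hS]
    refine ih (fun k hk => his k (List.mem_cons_of_mem _ hk)) (hrS ▸ hB.update hi hr) hv'
      fun t ht hcount => ?_
    rw [expect_pure]
    refine hg _ ht fun j => ?_
    rw [List.count_append, add_assoc, hcount, ← hrS, count_add_lower hB hi hr]

end Columns

/-! ### The main loop: uniformity and expected time -/

section Rows

variable {n : ℕ} (G : UniformGenerator)

theorem sampleRows_nil (κ : Kind) (b : ℕ) (B : Buckets n) :
    sampleRows G κ b [] B = tick b >>= fun _ => pure [] := rfl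

theorem sampleRows_cons (κ : Kind) (b k : ℕ) (u : List ℕ) (B : Buckets n) :
    sampleRows G κ b (k :: u) B = tick b >>= fun _ =>
      if ∀ i ∈ Finset.Icc 1 b, (B i).length = 0 then pure []
      else tick (b + 1) >>= fun _ =>
        G.draw (entry κ n b k u fun i => (B i).length).count >>= fun x =>
        (entry κ n b k u fun i => (B i).length).children.search x >>= fun s =>
        lowerColumns G s (levels κ b) B >>= fun r =>
        sampleRows G κ b u r.1 >>= fun rows => pure (r.2 :: rows) := rfl

/-- The children of a node with their weights. -/
noncomputable def items (κ : Kind) (n b k : ℕ) (u : List ℕ) (w : ℕ → ℕ) :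
    List ((ℕ →₀ ℕ) × ℕ) :=
  (childVectors κ b k w).toList.map fun s => (s, rowCount κ b w s * nodeCount κ n u (reduce w s))

theorem entry_children (κ : Kind) (n b k : ℕ) (u : List ℕ) (w : ℕ → ℕ) :
    (entry κ n b k u w).children = SearchTree.build (items κ n b k u w) := rfl

theorem entry_count {κ : Kind} {m b : ℕ} (p : Fin (m + 1) → ℕ) {v : Fin n → ℕ} {w : ℕ → ℕ}
    (hw : ∀ i, 1 ≤ i → countVec v i = w i) :
    (entry κ n b (p 0) (List.ofFn fun i => p i.succ) w).count = (tables κ p v).ncard := by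
  rw [← nodeCount_ofFn κ p hw, List.ofFn_succ, entry]

theorem sum_items {κ : Kind} {m b : ℕ} (p : Fin (m + 1) → ℕ) {v : Fin n → ℕ} {w : ℕ → ℕ}
    (hw : ∀ i, 1 ≤ i → countVec v i = w i) (hv : ∀ j, v j ≤ b) :
    ((items κ n b (p 0) (List.ofFn fun i => p i.succ) w).map Prod.snd).sum =
      (tables κ p v).ncard := by
  rw [← nodeCount_ofFn κ p hw, nodeCount_succ p hw hv, items, List.map_map]
  exact Finset.sum_map_toList _ _

theorem eq_zero_of_length_eq_zero {b : ℕ} {B : Buckets n} {v : Fin n → ℕ} (hv : ∀ j, v j ≤ b)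
    (hB : Stores B v) (h : ∀ i ∈ Finset.Icc 1 b, (B i).length = 0) (j : Fin n) : v j = 0 := by
  by_contra hj
  have h1 := h (v j) (Finset.mem_Icc.2 ⟨by omega, hv j⟩)
  have h2 := ((hB (v j) (by omega)).2 j).2 rfl
  rw [List.length_eq_zero_iff] at h1
  simp [h1] at h2

theorem toMatrix_cons {m : ℕ} (r : List (Fin n)) (rows : List (List (Fin n))) :
    (toMatrix (r :: rows) : Matrix (Fin (m + 1)) (Fin n) ℕ) =
      consRow (fun j => r.count j) (toMatrix rows) := by
  ext i j
  refine Fin.cases ?_ (fun i => ?_) i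
  · rfl
  · simp [consRow_succ, toMatrix]

/-- Every matrix is sampled at least with its fair share of the probability. -/
theorem le_expect_sampleRows {κ : Kind} {m b : ℕ} {p : Fin m → ℕ} {v : Fin n → ℕ}
    (hv : ∀ j, v j ≤ b) {B : Buckets n} (hB : Stores B v) {X : Matrix (Fin m) (Fin n) ℕ}
    (hX : X ∈ tables κ p v) {c : ℝ≥0∞} {g : List (List (Fin n)) → ℝ≥0∞}
    (hg : ∀ rows, toMatrix rows = X → c ≤ g rows) :
    c ≤ ((tables κ p v).ncard : ℝ≥0∞) * expect (sampleRows G κ b (List.ofFn p) B) g := by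
  classical
  have hpos : ∀ {m : ℕ} {p : Fin m → ℕ} {v : Fin n → ℕ} {X : Matrix (Fin m) (Fin n) ℕ},
      X ∈ tables κ p v → 1 ≤ (tables κ p v).ncard := fun hX =>
    (Set.ncard_pos (finite_tables _ _ _)).2 ⟨_, hX⟩
  induction m generalizing v B g with
  | zero =>
    rw [List.ofFn_zero, sampleRows_nil, expect_bind, expect_tick, expect_pure]
    refine (hg [] (Subsingleton.elim _ _)).trans (le_mul_of_one_le_left zero_le ?_)
    exact_mod_cast hpos hX
  | succ m ih =>
    have hw : ∀ i, 1 ≤ i → countVec v i = (B i).length := fun i hi => (hB.length hi).symm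
    rw [List.ofFn_succ, sampleRows_cons, expect_bind, expect_tick]
    split_ifs with hexit
    -- On early exit all column sums vanish, so `X` is zero, which is what `toMatrix` makes of
    -- missing rows.
    · rw [expect_pure]
      refine (hg [] ?_).trans (le_mul_of_one_le_left zero_le (by exact_mod_cast hpos hX))
      ext i j
      have h1 := eq_zero_of_length_eq_zero hv hB hexit j
      rw [← hX.2.2 j, Finset.sum_eq_zero_iff] at h1
      rw [h1 i (Finset.mem_univ i)]
      simp [toMatrix]
    · rw [expect_bind, expect_tick, expect_bind, entry_count p hw, entry_children,
        G.mul_expect_draw (hpos hX), ← sum_items p hw hv]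
      simp only [expect_bind]
      rw [expect_search, items, List.map_map]
      obtain ⟨hX', hstep, hle, hsum⟩ := tail_mem_tables hX
      obtain ⟨s, hs, hv'⟩ := exists_childVector hv hstep hsum
      rw [childVectors_congr hw] at hs
      -- Only the child on the way to `X` is kept. Of its weight, the number of rows is cancelled by
      -- `lowerColumns` and the count by the recursive call.
      refine le_trans ?_ (List.single_le_sum (fun _ _ => zero_le) _
        (List.mem_map.2 ⟨s, Finset.mem_toList.2 hs, rfl⟩))
      simp only [Function.comp_apply]
      rw [nodeCount_child _ hw hs hv', ← rowCount_congr hw, ← pathCount_levels hs, Nat.cast_mul,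
        mul_assoc, ← expect_mul_left]
      refine le_expect_lowerColumns G (fun i hi => (mem_levels.1 hi).1) hB hv' fun t ht hcount => ?_
      refine ih (fun j => (Nat.sub_le _ _).trans (hv j)) ht hX' fun rows hrows => ?_
      rw [expect_pure]
      refine hg _ ?_
      rw [toMatrix_cons, hrows]
      ext i j
      refine Fin.cases ?_ (fun i => rfl) i
      have := hcount j
      have := hle j
      rw [consRow_zero]
      omega

/-- A child that is found has positive weight. Hence some row leads to it and its count is positive,
which keeps the loop going. -/
theorem ensures_child {κ : Kind} {m b : ℕ} (p : Fin (m + 1) → ℕ) {v : Fin n → ℕ} {B : Buckets n}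
    (hB : Stores B v) (hv : ∀ j, v j ≤ b) {x : ℕ} (hx : 1 ≤ x ∧ x ≤ (tables κ p v).ncard) :
    ((entry κ n b (p 0) (List.ofFn fun i => p i.succ) fun i => (B i).length).children.search
      x).Ensures fun s => s ∈ childVectors κ b (p 0) (countVec v) ∧
        pathCount s (levels κ b) (countVec v) ≠ 0 ∧
        ∀ v' ∈ outcomes s (levels κ b) v, 1 ≤ (tables κ (fun i => p i.succ) v').ncard := by
  have hw : ∀ i, 1 ≤ i → countVec v i = (B i).length := fun i hi => (hB.length hi).symm
  rw [entry_children]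
  refine (ensures_search _ x hx.1 (by rw [sum_items p hw hv]; exact hx.2)).mono ?_
  rintro s ⟨k, hk, hmem⟩
  obtain ⟨s', hs', h⟩ := List.mem_map.1 hmem
  obtain ⟨rfl, rfl⟩ := Prod.mk.inj h
  have hs := Finset.mem_toList.1 hs'
  obtain ⟨h1, h2⟩ := mul_ne_zero_iff.1 (Nat.one_le_iff_ne_zero.1 hk)
  refine ⟨childVectors_congr hw ▸ hs, by rwa [pathCount_levels hs, rowCount_congr hw],
    fun v' hv' => ?_⟩
  rw [← nodeCount_child _ hw hs hv']
  exact Nat.one_le_iff_ne_zero.2 h2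

theorem sum_levels (κ : Kind) (b : ℕ) (f : ℕ → ℝ≥0∞) :
    ((levels κ b).map f).sum = ∑ i ∈ Finset.Icc 1 b, f i := by
  rw [← List.sum_toFinset f (nodup_levels κ b)]
  congr 1
  ext i
  rw [List.mem_toFinset, mem_levels, Finset.mem_Icc]

/-- The term `(m + 1) * b` pays for the exit tests, including the last one. Here `a`, `c` and `N`
are mere upper bounds, so they survive the passage to the remaining rows. -/
theorem expectedTime_sampleRows_le {κ : Kind} {m a b c N : ℕ} {p : Fin m → ℕ} {v : Fin n → ℕ}
    (hv : ∀ j, v j ≤ b) {B : Buckets n} (hB : Stores B v) (ht : 1 ≤ (tables κ p v).ncard)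
    (hN : (Finset.univ.filter fun j => v j ≠ 0).card ≤ N) (hN1 : 1 ≤ N)
    (ha : ∀ i, p i ≤ a) (hc : ∑ i, p i ≤ c) :
    (sampleRows G κ b (List.ofFn p) B).expectedTime ≤ (m + 1) * b + m * ((b + 1) +
      (G.Tr (N ^ c) + ((2 * (b * Nat.clog 2 (a + 1)) + 1) + (2 * b + a * (G.Tr N + 6))))) := by
  induction m generalizing v B c with
  | zero =>
    simp [sampleRows_nil, expectedTime_tick_bind, expectedTime_pure]
  | succ m ih =>
    have hw : ∀ i, 1 ≤ i → countVec v i = (B i).length := fun i hi => (hB.length hi).symm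
    rw [List.ofFn_succ, sampleRows_cons, expectedTime_tick_bind]
    set R : ℝ≥0∞ := (b + 1) + (G.Tr (N ^ c) + ((2 * (b * Nat.clog 2 (a + 1)) + 1) +
      (2 * b + a * (G.Tr N + 6)))) with hR
    have hsplit : (((m + 1 : ℕ) : ℝ≥0∞) + 1) * b + ((m + 1 : ℕ) : ℝ≥0∞) * R =
        b + (R + ((m + 1) * b + m * R)) := by push_cast; ring
    rw [hsplit]
    gcongr
    split_ifs with hexit
    · rw [expectedTime_pure]; exact zero_le
    rw [expectedTime_tick_bind]
    have hcount := entry_count (b := b) (κ := κ) p hw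
    have hsum : ∑ i : Fin m, p i.succ ≤ c := by
      rw [Fin.sum_univ_succ] at hc
      omega
    refine (add_le_add_right (expectedTime_bind_le (s := G.Tr (N ^ c))
      (t := (2 * (b * Nat.clog 2 (a + 1)) + 1) + ((2 * b + a * (G.Tr N + 6)) +
        ((m + 1) * b + m * R)))
      (G.expectedTime_draw_le (hcount ▸ ht) ?_) (G.ensures_draw (hcount ▸ ht)) fun x hx => ?_)
      _).trans (le_of_eq (by rw [hR]; push_cast; ring))
    · rw [hcount]
      exact (ncard_tables_le κ p v).trans ((Nat.pow_le_pow_left hN _).trans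
        (Nat.pow_le_pow_right hN1 hc))
    rw [hcount] at hx
    refine expectedTime_bind_le ?_ (ensures_child p hB hv hx) fun s ⟨hs, hpc, hnext⟩ =>
      expectedTime_bind_le ?_ (ensures_lowerColumns G (fun i hi => (mem_levels.1 hi).1) hB hpc)
        fun t ⟨v', hv', ht', hcount'⟩ => ?_
    · rw [entry_children]
      refine (expectedTime_search_le _ x).trans ?_
      rw [items, List.length_map, Finset.length_toList]
      have h1 := (card_childVectors_le κ b (p 0) fun i => (B i).length).trans
        (Nat.pow_le_pow_left (Nat.succ_le_succ (ha 0)) b)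
      have h2 := Nat.clog_le_of_le_pow (h1.trans (Nat.pow_le_pow_left
        (Nat.le_pow_clog one_lt_two (a + 1)) b) |>.trans_eq (pow_mul _ _ _).symm)
      rw [mul_comm] at h2
      exact_mod_cast (by omega :
        2 * Nat.clog 2 (childVectors κ b (p 0) fun i => (B i).length).card + 1 ≤
          2 * (b * Nat.clog 2 (a + 1)) + 1)
    · refine (expectedTime_lowerColumns_le G (fun i hi => (mem_levels.1 hi).1) hB hpc hN).trans ?_
      rw [sum_levels, Finset.sum_add_distrib, ← Finset.sum_mul, ← Nat.cast_sum,
        sum_of_mem_childVectors hs, Finset.sum_const, Nat.card_Icc, Nat.add_sub_cancel,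
        nsmul_eq_mul, mul_comm (b : ℝ≥0∞)]
      gcongr
      exact ha 0
    · have hle := outcomes_le hv'
      refine (expectedTime_bind_le (ih (fun j => (hle j).trans (hv j)) ht' (hnext v' hv')
        ((card_ne_zero_mono hle).trans hN) (fun i => ha _) hsum) (ensures_true _) (t := 0)
        fun rows _ => ?_).trans (by rw [add_zero])
      rw [expectedTime_pure]

/-- The output of the algorithm is uniformly distributed. -/
theorem output_sample_apply {κ : Kind} {m : ℕ} {p : Fin m → ℕ} {q : Fin n → ℕ}
    (hne : (tables κ p q).Nonempty) (X : Matrix (Fin m) (Fin n) ℕ) :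
    ((sample G κ p q).output.map toMatrix) X =
      (tables κ p q).indicator (fun _ => ((tables κ p q).ncard : ℝ≥0∞)⁻¹) X := by
  classical
  set μ : PMF (Matrix (Fin m) (Fin n) ℕ) := (sample G κ p q).output.map toMatrix with hμ
  have hfin := finite_tables κ p q
  have h0 : ((tables κ p q).ncard : ℝ≥0∞) ≠ 0 := by
    exact_mod_cast ((Set.ncard_pos hfin).2 hne).ne'
  have htop : ((tables κ p q).ncard : ℝ≥0∞) ≠ ⊤ := ENNReal.natCast_ne_top _
  have hlow : ∀ X ∈ tables κ p q, ((tables κ p q).ncard : ℝ≥0∞)⁻¹ ≤ μ X := by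
    intro X hX
    rw [ENNReal.inv_le_iff_le_mul (fun _ => h0) (fun h => absurd h htop)]
    have h1 : μ X = expect (sampleRows G κ (Finset.univ.sup q) (List.ofFn p) (initialBuckets q))
        fun rows => if X = toMatrix rows then 1 else 0 := by
      have h2 : (sample G κ p q).expect (fun rows => if X = toMatrix rows then 1 else 0) = μ X := by
        rw [expect_eq_output, hμ, PMF.map_apply]
        simp only [mul_ite, mul_one, mul_zero]
        congr!
      rw [← h2, sample, expect_bind, expect_tick]
    rw [h1]
    refine le_expect_sampleRows G (fun j => Finset.le_sup (Finset.mem_univ j))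
      (stores_initialBuckets q) hX fun rows hrows => ?_
    rw [if_pos hrows.symm]
  have hmass : ∑' X, (tables κ p q).indicator (fun _ => ((tables κ p q).ncard : ℝ≥0∞)⁻¹) X = 1 := by
    rw [← tsum_subtype, ENNReal.tsum_set_const, ← hfin.cast_ncard_eq, ENat.toENNReal_coe,
      ENNReal.mul_inv_cancel h0 htop]
  have hle : ∀ X, (tables κ p q).indicator (fun _ => ((tables κ p q).ncard : ℝ≥0∞)⁻¹) X ≤ μ X :=
    fun X => Set.indicator_apply_le (hlow X)
  -- Both sides have total mass one, so a strict inequality at a single matrix is impossible.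
  refine le_antisymm ?_ (hle X)
  by_contra hlt
  have := ENNReal.tsum_lt_tsum (hmass ▸ ENNReal.one_ne_top) hle (not_le.1 hlt)
  rw [hmass, PMF.tsum_coe] at this
  exact lt_irrefl _ this

theorem expectedTime_sample_le {κ : Kind} {m a c N : ℕ} {p : Fin m → ℕ} {q : Fin n → ℕ}
    (hne : (tables κ p q).Nonempty) (hN : (Finset.univ.filter fun j => q j ≠ 0).card = N)
    (hN1 : 1 ≤ N) (ha : ∀ i, p i ≤ a) (hc : ∑ i, p i = c) :
    (sample G κ p q).expectedTime ≤ (Finset.univ.sup q + N) + ((m + 1) * Finset.univ.sup q +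
      m * ((Finset.univ.sup q + 1) + (G.Tr (N ^ c) +
        ((2 * (Finset.univ.sup q * Nat.clog 2 (a + 1)) + 1) +
          (2 * Finset.univ.sup q + a * (G.Tr N + 6)))))) := by
  rw [sample, expectedTime_tick_bind, hN, Nat.cast_add]
  gcongr
  exact expectedTime_sampleRows_le G (fun j => Finset.le_sup (Finset.mem_univ j))
    (stores_initialBuckets q) ((Set.ncard_pos (finite_tables _ _ _)).2 hne) hN.le hN1 ha hc.le

end Rows

/-! ### Asymptotic bounds on the expected time -/

section Asymptotics

theorem clog_two_le {S : ℕ} (hS : 2 ≤ S) : (Nat.clog 2 S : ℝ) ≤ 4 * Real.log S := by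
  have h1 := Nat.pow_pred_clog_lt_self one_lt_two (show 1 < S by omega)
  have h2 : 1 ≤ Nat.clog 2 S := Nat.clog_pos one_lt_two hS
  obtain ⟨k, hk⟩ : ∃ k, Nat.clog 2 S = k + 1 := ⟨Nat.clog 2 S - 1, by omega⟩
  rw [hk] at h1 ⊢
  simp only [Nat.pred_eq_sub_one, Nat.add_sub_cancel] at h1
  have h3 : (k : ℝ) * Real.log 2 ≤ Real.log S := by
    rw [← Real.log_pow]
    exact Real.log_le_log (by positivity) (by exact_mod_cast h1.le)
  have h4 : Real.log 2 ≤ Real.log S := Real.log_le_log (by norm_num) (by exact_mod_cast hS)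
  have h5 := Real.log_two_gt_d9
  have h6 : (k : ℝ) * 0.6931471803 ≤ k * Real.log 2 := by gcongr
  push_cast
  linarith

theorem one_le_two_mul_log {S : ℝ} (hS : 2 ≤ S) : 1 ≤ 2 * Real.log S := by
  have h4 : Real.log 2 ≤ Real.log S := Real.log_le_log (by norm_num) hS
  have h5 := Real.log_two_gt_d9
  linarith

theorem natCast_le_mul_ofReal {x k : ℕ} {r : ℝ} (h : (x : ℝ) ≤ k * r) :
    (x : ℝ≥0∞) ≤ k * ENNReal.ofReal r := by
  rw [← ENNReal.ofReal_natCast x, ← ENNReal.ofReal_natCast k, ← ENNReal.ofReal_mul (by positivity)]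
  exact ENNReal.ofReal_le_ofReal h

variable {κ : Kind} {m n a b c : ℕ} {p : Fin m → ℕ} {q : Fin n → ℕ} (G : UniformGenerator)

/-- The number of nonzero entries is at most the sum. -/
theorem card_ne_zero_le_sum (q : Fin n → ℕ) :
    (Finset.univ.filter fun j => q j ≠ 0).card ≤ ∑ j, q j := by
  rw [Finset.card_eq_sum_ones]
  refine (Finset.sum_le_sum fun j hj => ?_).trans
    (Finset.sum_le_sum_of_subset (Finset.filter_subset _ _))
  have := (Finset.mem_filter.1 hj).2
  omega

theorem sup_le_sum (q : Fin n → ℕ) : Finset.univ.sup q ≤ ∑ j, q j :=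
  Finset.sup_le fun _ hj => Finset.single_le_sum (f := q) (fun _ _ => Nat.zero_le _) hj

theorem sum_le_mul_sup (p : Fin m → ℕ) : ∑ i, p i ≤ m * Finset.univ.sup p := by
  simpa using Finset.sum_le_card_nsmul Finset.univ p _ fun i hi => Finset.le_sup hi

theorem expectedTime_sample_le' {N : ℕ} (ha : a = Finset.univ.sup p) (hb : b = Finset.univ.sup q)
    (hp : c = ∑ i, p i) (hq : c = ∑ j, q j) (hc : 1 ≤ c) (hne : (tables κ p q).Nonempty)
    (hN : (Finset.univ.filter fun j => q j ≠ 0).card = N) :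
    1 ≤ b ∧ 1 ≤ a ∧ 1 ≤ N ∧ (sample G κ p q).expectedTime ≤ 8 * ((m * b : ℕ) : ℝ≥0∞) +
      2 * ((m * b * Nat.clog 2 (a + 1) : ℕ) : ℝ≥0∞) + m * G.Tr (N ^ c) + m * a * G.Tr N +
        7 * ((m * a : ℕ) : ℝ≥0∞) := by
  have hma : c ≤ m * a := by rw [hp, ha]; exact sum_le_mul_sup p
  have hm1 : 1 ≤ m := Nat.pos_of_ne_zero fun h => by simp [h] at hma; omega
  have ha1 : 1 ≤ a := Nat.pos_of_ne_zero fun h => by simp [h] at hma; omega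
  have hnb : c ≤ n * b := by rw [hq, hb]; exact sum_le_mul_sup q
  have hb1 : 1 ≤ b := Nat.pos_of_ne_zero fun h => by simp [h] at hnb; omega
  have hN1 : 1 ≤ N := by
    by_contra h0
    have h1 : ∀ j, q j = 0 := by simpa using (hN.trans (by omega) : _ = 0)
    simp [h1] at hq
    omega
  refine ⟨hb1, ha1, hN1, ?_⟩
  have hNma : N ≤ m * a := by
    rw [← hN]
    exact (card_ne_zero_le_sum q).trans (hq ▸ hma)
  refine (expectedTime_sample_le G hne hN hN1
    (fun i => ha ▸ Finset.le_sup (Finset.mem_univ i)) hp.symm).trans ?_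
  rw [← hb]
  have h1 : (b : ℝ≥0∞) ≤ ((m * b : ℕ) : ℝ≥0∞) := by exact_mod_cast Nat.le_mul_of_pos_left b hm1
  have h2 : (m : ℝ≥0∞) ≤ ((m * b : ℕ) : ℝ≥0∞) := by exact_mod_cast Nat.le_mul_of_pos_right m hb1
  have h3 : (N : ℝ≥0∞) ≤ ((m * a : ℕ) : ℝ≥0∞) := by exact_mod_cast hNma
  calc _ = (b + N + b + m + m) + (4 * ((m * b : ℕ) : ℝ≥0∞) +
      2 * ((m * b * Nat.clog 2 (a + 1) : ℕ) : ℝ≥0∞) + m * G.Tr (N ^ c) + m * a * G.Tr N +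
        6 * ((m * a : ℕ) : ℝ≥0∞)) := by push_cast; ring
    _ ≤ (((m * b : ℕ) : ℝ≥0∞) + ((m * a : ℕ) : ℝ≥0∞) + ((m * b : ℕ) : ℝ≥0∞) +
        ((m * b : ℕ) : ℝ≥0∞) + ((m * b : ℕ) : ℝ≥0∞)) + (4 * ((m * b : ℕ) : ℝ≥0∞) +
      2 * ((m * b * Nat.clog 2 (a + 1) : ℕ) : ℝ≥0∞) + m * G.Tr (N ^ c) + m * a * G.Tr N +
        6 * ((m * a : ℕ) : ℝ≥0∞)) := by gcongr
    _ = _ := by ring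

/-- `M` stands for `n ^ c` or `(2 * c) ^ c`. The constant is `38 = 15 * 2 + 8`, the coefficient
collected by the logarithmic term. -/
theorem expectedTime_sample_le_of_pow_le {M : ℕ} (ha : a = Finset.univ.sup p)
    (hb : b = Finset.univ.sup q) (hp : c = ∑ i, p i) (hq : c = ∑ j, q j) (hc : 1 ≤ c)
    (hne : (tables κ p q).Nonempty) (hM : (min n c) ^ c ≤ M) :
    (sample G κ p q).expectedTime ≤ 38 * (m * G.Tr M + m * a * G.Tr n +
      ENNReal.ofReal (m * b * Real.log (a + b))) := by
  obtain ⟨hb1, ha1, hN1, h⟩ := expectedTime_sample_le' G ha hb hp hq hc hne rfl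
  set N := (Finset.univ.filter fun j => q j ≠ 0).card with hN
  have hNn : N ≤ n := by simpa using Finset.card_filter_le Finset.univ fun j => q j ≠ 0
  have hNc : N ≤ c := hq ▸ card_ne_zero_le_sum q
  have hS : (2 : ℝ) ≤ a + b := by exact_mod_cast (by omega : 2 ≤ a + b)
  set Λ := ENNReal.ofReal (m * b * Real.log (a + b)) with hΛ
  have h1 : ((m * b : ℕ) : ℝ≥0∞) ≤ (2 : ℕ) * Λ := by
    refine natCast_le_mul_ofReal ?_
    have := one_le_two_mul_log hS
    calc ((m * b : ℕ) : ℝ) = m * b * 1 := by push_cast; ring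
      _ ≤ m * b * (2 * Real.log (a + b)) := by gcongr
      _ = _ := by push_cast; ring
  have h2 : ((m * b * Nat.clog 2 (a + 1) : ℕ) : ℝ≥0∞) ≤ (4 : ℕ) * Λ := by
    refine natCast_le_mul_ofReal ?_
    have h3 := clog_two_le (by omega : 2 ≤ a + b)
    have h4 : (Nat.clog 2 (a + 1) : ℝ) ≤ Nat.clog 2 (a + b) := by
      exact_mod_cast Nat.clog_mono_right 2 (by omega : a + 1 ≤ a + b)
    calc ((m * b * Nat.clog 2 (a + 1) : ℕ) : ℝ) = m * b * Nat.clog 2 (a + 1) := by push_cast; ring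
      _ ≤ m * b * (4 * Real.log ((a + b : ℕ) : ℝ)) := by gcongr; exact h4.trans h3
      _ = _ := by push_cast; ring
  -- With a single column the draws may be free; then `b` is the total sum, so `a ≤ b` and the
  -- second summand suffices.
  have h3 : ((m * a : ℕ) : ℝ≥0∞) ≤ m * a * G.Tr n + ((m * b : ℕ) : ℝ≥0∞) := by
    by_cases hn : 2 ≤ n
    · refine le_trans ?_ le_self_add
      rw [Nat.cast_mul]
      exact le_mul_of_one_le_right zero_le (G.one_le_Tr hn)
    · refine le_trans ?_ le_add_self
      have hn1 : n = 1 := by omega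
      subst hn1
      have : a ≤ b := by
        rw [ha, hb]
        refine (sup_le_sum p).trans ?_
        rw [← hp, hq, Fin.sum_univ_one]
        exact Finset.le_sup (Finset.mem_univ (0 : Fin 1))
      exact_mod_cast Nat.mul_le_mul_left m this
  have h4 : G.Tr (N ^ c) ≤ G.Tr M :=
    G.Tr_mono ((Nat.pow_le_pow_left (le_min hNn hNc) c).trans hM)
  have h5 : G.Tr N ≤ G.Tr n := G.Tr_mono hNn
  calc _ ≤ _ := h
    _ ≤ 8 * ((m * b : ℕ) : ℝ≥0∞) + 2 * ((4 : ℕ) * Λ) + m * G.Tr M + m * a * G.Tr n +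
        7 * (m * a * G.Tr n + ((m * b : ℕ) : ℝ≥0∞)) := by gcongr
    _ = 15 * ((m * b : ℕ) : ℝ≥0∞) + 8 * Λ + 1 * (m * G.Tr M) + 8 * (m * a * G.Tr n) := by
      push_cast; ring
    _ ≤ 15 * ((2 : ℕ) * Λ) + 8 * Λ + 38 * (m * G.Tr M) + 38 * (m * a * G.Tr n) := by
      gcongr <;> norm_num
    _ = _ := by push_cast; ring

theorem log_max_le {x k : ℕ} (hx : 1 ≤ x) :
    Real.log ((max x k : ℕ) : ℝ) ≤ Real.log x + Real.log (k + 1) := by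
  have hx' : (0 : ℝ) < x := by exact_mod_cast hx
  rw [← Real.log_mul hx'.ne' (by positivity)]
  refine Real.log_le_log (by exact_mod_cast (by omega : 0 < max x k)) ?_
  exact_mod_cast max_le (Nat.le_mul_of_pos_right x (by omega))
    ((Nat.le_succ k).trans (Nat.le_mul_of_pos_left _ hx))

/-- Below `k₀` monotonicity compares with `max y k₀`; its logarithm exceeds `log y` by at most `log
(k₀ + 1)`, which `1 ≤ 2 log y` turns into a factor. -/
theorem Tr_le_of_log {K : ℝ≥0} {k₀ : ℕ}
    (hG : ∀ k, k₀ ≤ k → G.Tr k ≤ ENNReal.ofReal (K * Real.log k)) {x y : ℕ} (hxy : x ≤ y)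
    (hy : 2 ≤ y) :
    G.Tr x ≤ ENNReal.ofReal (K * (1 + 2 * Real.log (k₀ + 1))) * ENNReal.ofReal (Real.log y) := by
  have h0 : 0 ≤ Real.log ((k₀ : ℝ) + 1) := Real.log_nonneg (by simp)
  refine (G.Tr_mono (hxy.trans (le_max_left y k₀))).trans ((hG _ (le_max_right _ _)).trans ?_)
  rw [← ENNReal.ofReal_mul (by positivity), mul_assoc]
  refine ENNReal.ofReal_le_ofReal ?_
  gcongr
  have h1 := log_max_le (k := k₀) (by omega : 1 ≤ y)
  have h2 := one_le_two_mul_log (S := y) (by exact_mod_cast hy)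
  nlinarith

/-- Everything is compared with `c`: `a`, `b` and `N` are at most `c`, and `log (c ^ c) = c log c`.
The constant is `46 = 8 * 2 + 2 * 8 + 7 * 2`. -/
theorem expectedTime_sample_le_of_log {K : ℝ≥0} {k₀ : ℕ}
    (hG : ∀ k, k₀ ≤ k → G.Tr k ≤ ENNReal.ofReal (K * Real.log k))
    (hp : c = ∑ i, p i) (hq : c = ∑ j, q j) (hc : 2 ≤ c) (hne : (tables κ p q).Nonempty) :
    (sample G κ p q).expectedTime ≤
      (46 + 2 * ENNReal.ofReal (K * (1 + 2 * Real.log (k₀ + 1)))) *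
        ENNReal.ofReal (m * c * Real.log c) := by
  obtain ⟨hb1, ha1, hN1, h⟩ := expectedTime_sample_le' G rfl rfl hp hq (by omega) hne rfl
  set N := (Finset.univ.filter fun j => q j ≠ 0).card with hN
  set a := Finset.univ.sup p with ha
  set b := Finset.univ.sup q with hb
  have hNc : N ≤ c := hq ▸ card_ne_zero_le_sum q
  have hac : a ≤ c := hp ▸ sup_le_sum p
  have hbc : b ≤ c := hq ▸ sup_le_sum q
  have hc2 : (2 : ℝ) ≤ c := by exact_mod_cast hc
  have hlog := one_le_two_mul_log hc2
  set Γ := ENNReal.ofReal (m * c * Real.log c) with hΓ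
  set K' := ENNReal.ofReal (K * (1 + 2 * Real.log (k₀ + 1))) with hK'
  have h0 : ∀ x : ℕ, x ≤ c → ((m * x : ℕ) : ℝ≥0∞) ≤ (2 : ℕ) * Γ := by
    intro x hx
    refine natCast_le_mul_ofReal ?_
    calc ((m * x : ℕ) : ℝ) = m * x * 1 := by push_cast; ring
      _ ≤ m * c * (2 * Real.log c) := by gcongr
      _ = _ := by push_cast; ring
  have h2 : ((m * b * Nat.clog 2 (a + 1) : ℕ) : ℝ≥0∞) ≤ (8 : ℕ) * Γ := by
    refine natCast_le_mul_ofReal ?_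
    have h3 := clog_two_le (by nlinarith : 2 ≤ c ^ 2)
    have h4 : (Nat.clog 2 (a + 1) : ℝ) ≤ Nat.clog 2 (c ^ 2) := by
      exact_mod_cast Nat.clog_mono_right 2 (by nlinarith : a + 1 ≤ c ^ 2)
    rw [Nat.cast_pow, Real.log_pow] at h3
    calc ((m * b * Nat.clog 2 (a + 1) : ℕ) : ℝ) = m * b * Nat.clog 2 (a + 1) := by push_cast; ring
      _ ≤ m * c * (4 * ((2 : ℕ) * Real.log c)) := by gcongr; exact h4.trans h3
      _ = _ := by push_cast; ring
  have h3 : m * G.Tr (N ^ c) ≤ K' * Γ := by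
    have hcc : 2 ≤ c ^ c := hc.trans (Nat.le_self_pow (by omega) c)
    calc m * G.Tr (N ^ c) ≤ m * (K' * ENNReal.ofReal (Real.log ((c ^ c : ℕ) : ℝ))) := by
          gcongr
          exact Tr_le_of_log G hG (Nat.pow_le_pow_left hNc c) hcc
      _ = K' * (ENNReal.ofReal m * ENNReal.ofReal (Real.log ((c ^ c : ℕ) : ℝ))) := by
          rw [ENNReal.ofReal_natCast]; ring
      _ = K' * Γ := by
          rw [← ENNReal.ofReal_mul (by positivity), Nat.cast_pow, Real.log_pow, ← mul_assoc]
  have h4 : m * a * G.Tr N ≤ K' * Γ := by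
    calc m * a * G.Tr N ≤ m * c * (K' * ENNReal.ofReal (Real.log c)) := by
          gcongr
          exact Tr_le_of_log G hG hNc hc
      _ = K' * (ENNReal.ofReal m * ENNReal.ofReal c * ENNReal.ofReal (Real.log c)) := by
          rw [ENNReal.ofReal_natCast, ENNReal.ofReal_natCast]; ring
      _ = K' * Γ := by
          rw [← ENNReal.ofReal_mul (by positivity), ← ENNReal.ofReal_mul (by positivity)]
  calc _ ≤ _ := h
    _ ≤ 8 * ((2 : ℕ) * Γ) + 2 * ((8 : ℕ) * Γ) + K' * Γ + K' * Γ + 7 * ((2 : ℕ) * Γ) := by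
      gcongr
      · exact h0 b hbc
      · exact h0 a hac
    _ = _ := by push_cast; ring

end Asymptotics

/-! ### Rejection sampling -/

section Rejection

/-- The expectation of a function of the result and the time. -/
noncomputable def Timed.jointExpect {α : Type} (x : Timed α) (g : α × ℕ → ℝ≥0∞) : ℝ≥0∞ :=
  ∑' y : α × ℕ, x.law y * g y

theorem jointExpect_pure {α : Type} (a : α) (g : α × ℕ → ℝ≥0∞) :
    jointExpect (pure a) g = g (a, 0) := by
  rw [jointExpect, law_pure, tsum_pmf_pure_mul]

theorem jointExpect_bind {α β : Type} (x : Timed α) (f : α → Timed β) (g : β × ℕ → ℝ≥0∞) :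
    jointExpect (x >>= f) g =
      jointExpect x fun y => jointExpect (f y.1) fun z => g (z.1, y.2 + z.2) := by
  rw [jointExpect, law_bind, tsum_pmf_bind_mul]
  simp_rw [tsum_pmf_map_mul]
  rfl

theorem Timed.ext_jointExpect {α : Type} {x x' : Timed α}
    (h : ∀ g, jointExpect x g = jointExpect x' g) : x = x' := by
  classical
  refine Timed.ext (PMF.ext fun y => ?_)
  have := h fun z => if z = y then 1 else 0
  simpa [jointExpect, tsum_ite_eq] using this

theorem two_mul_jointExpect_randomBit (g : Bool × ℕ → ℝ≥0∞) :
    2 * jointExpect randomBit g = g (false, 1) + g (true, 1) := by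
  rw [jointExpect, randomBit, tsum_pmf_map_mul, tsum_fintype, Fintype.sum_bool]
  simp only [PMF.uniformOfFintype_apply, Fintype.card_bool, Nat.cast_ofNat]
  rw [← mul_add, ← mul_assoc, ENNReal.mul_inv_cancel (by simp) (by simp), one_mul, add_comm]

theorem sum_range_two_mul (f : ℕ → ℝ≥0∞) (M : ℕ) :
    ∑ x ∈ Finset.range (2 * M), f x = ∑ x ∈ Finset.range M, f (2 * x) +
      ∑ x ∈ Finset.range M, f (2 * x + 1) := by
  induction M with
  | zero => simp
  | succ M ih =>
    rw [mul_add, mul_one, Finset.sum_range_succ, Finset.sum_range_succ, ih,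
      Finset.sum_range_succ, Finset.sum_range_succ]
    ring

/-- The first bit decides the parity, so the sum splits into even and odd numbers. The time is
always `L`. -/
theorem mul_jointExpect_randomBits (L : ℕ) (g : ℕ × ℕ → ℝ≥0∞) :
    ((2 ^ L : ℕ) : ℝ≥0∞) * jointExpect (randomBits L) g =
      ∑ x ∈ Finset.range (2 ^ L), g (x, L) := by
  induction L generalizing g with
  | zero => simp [randomBits, jointExpect_pure]
  | succ L ih =>
    rw [randomBits, jointExpect_bind, pow_succ, mul_comm (2 ^ L), sum_range_two_mul,
      mul_comm 2, Nat.cast_mul, Nat.cast_ofNat, mul_assoc, two_mul_jointExpect_randomBit, mul_add]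
    simp only [jointExpect_bind, jointExpect_pure, ih, Bool.toNat_false, Bool.toNat_true, add_zero,
      add_comm 1 L]

/-- The geometric distribution with failure probability `r` and success probability `s`. -/
noncomputable def geometric (r s : ℝ≥0∞) (h : r + s = 1) (hs : s ≠ 0) : PMF ℕ :=
  ⟨fun t => r ^ t * s, by
    have hr : r ≠ ⊤ := fun h' => by simp [h'] at h
    have hs' : s ≠ ⊤ := fun h' => by simp [h'] at h
    have h1 : 1 - r = s := by rw [← h, ENNReal.add_sub_cancel_left hr]
    have h2 : ∑' t : ℕ, r ^ t * s = 1 := by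
      rw [ENNReal.tsum_mul_right, ENNReal.tsum_geometric, h1, ENNReal.inv_mul_cancel hs hs']
    exact h2 ▸ ENNReal.summable.hasSum⟩

theorem geometric_apply {r s : ℝ≥0∞} (h : r + s = 1) (hs : s ≠ 0) (t : ℕ) :
    geometric r s h hs t = r ^ t * s := rfl

theorem tsum_geometric_mul {r s : ℝ≥0∞} (h : r + s = 1) (hs : s ≠ 0) (f : ℕ → ℝ≥0∞) :
    ∑' t, geometric r s h hs t * f t = s * f 0 + r * ∑' t, geometric r s h hs t * f (t + 1) := by
  rw [tsum_eq_zero_add' ENNReal.summable, ← ENNReal.tsum_mul_left]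
  simp only [geometric_apply, pow_zero, one_mul, pow_succ']
  congr 1
  exact tsum_congr fun t => by ring

theorem tsum_geometric_mul_add_one_le {r s : ℝ≥0∞} (h : r + s = 1) (hs : s ≠ 0)
    (hr : 2 * r ≤ 1) : ∑' t, geometric r s h hs t * ((t : ℝ≥0∞) + 1) ≤ 8 := by
  have hs1 : s ≤ 1 := h ▸ le_add_self
  have hr' : r ≤ ((1 / 2 : ℝ≥0) : ℝ≥0∞) := by
    rw [ENNReal.coe_div two_ne_zero, ENNReal.coe_one, ENNReal.coe_ofNat,
      ENNReal.le_div_iff_mul_le (by simp) (by simp), mul_comm]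
    exact hr
  -- With `t + 2` in place of `t + 1` each step gains the factor `3 / 4` already from `t = 0`. The
  -- resulting geometric series has sum `2 * 4 = 8`.
  have key : ∀ t : ℕ, (1 / 2 : ℝ≥0) ^ t * (t + 2) ≤ 2 * (3 / 4) ^ t := by
    intro t
    induction t with
    | zero => norm_num
    | succ t ih =>
      calc (1 / 2 : ℝ≥0) ^ (t + 1) * ((t + 1 : ℕ) + 2)
          = (1 / 2) ^ t * ((t + 3) / 2) := by push_cast; ring
        _ ≤ (1 / 2) ^ t * (3 / 4 * (t + 2)) := by
            gcongr
            rw [← NNReal.coe_le_coe]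
            push_cast
            linarith [t.cast_nonneg (α := ℝ)]
        _ = 3 / 4 * ((1 / 2) ^ t * (t + 2)) := by ring
        _ ≤ 3 / 4 * (2 * (3 / 4) ^ t) := by gcongr
        _ = 2 * (3 / 4) ^ (t + 1) := by ring
  have h1 : (1 : ℝ≥0∞) - ((3 / 4 : ℝ≥0) : ℝ≥0∞) = ((4⁻¹ : ℝ≥0) : ℝ≥0∞) := by
    rw [← ENNReal.coe_one, ← ENNReal.coe_sub]
    congr 1
    rw [tsub_eq_iff_eq_add_of_le] <;> norm_num [← NNReal.coe_inj, ← NNReal.coe_le_coe]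
  calc ∑' t, geometric r s h hs t * ((t : ℝ≥0∞) + 1)
      ≤ ∑' t : ℕ, 2 * ((3 / 4 : ℝ≥0) : ℝ≥0∞) ^ t := by
        refine ENNReal.tsum_le_tsum fun t => ?_
        rw [geometric_apply]
        calc r ^ t * s * ((t : ℝ≥0∞) + 1)
            ≤ ((1 / 2 : ℝ≥0) : ℝ≥0∞) ^ t * 1 * ((t : ℝ≥0∞) + 2) := by gcongr; norm_num
          _ ≤ _ := by rw [mul_one]; exact_mod_cast key t
    _ = 8 := by
        rw [ENNReal.tsum_mul_left, ENNReal.tsum_geometric, h1, ENNReal.coe_inv (by norm_num),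
          inv_inv]
        norm_num

theorem le_two_pow_clog (j : ℕ) : j ≤ 2 ^ Nat.clog 2 j := Nat.le_pow_clog one_lt_two j

theorem two_pow_clog_le {j : ℕ} (hj : 1 ≤ j) : 2 ^ Nat.clog 2 j ≤ 2 * j := by
  rcases hj.eq_or_lt with rfl | hj
  · simp
  · have h1 := Nat.pow_pred_clog_lt_self one_lt_two hj
    have h2 : 0 < Nat.clog 2 j := Nat.clog_pos one_lt_two hj
    obtain ⟨k, hk⟩ : ∃ k, Nat.clog 2 j = k + 1 := ⟨Nat.clog 2 j - 1, by omega⟩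
    rw [hk] at h1 ⊢
    simp only [Nat.pred_eq_sub_one, Nat.add_sub_cancel] at h1
    rw [pow_succ]
    omega

/-- The probability that a round of rejection sampling from `{1, …, j}` fails. -/
noncomputable def failure (j : ℕ) : ℝ≥0∞ :=
  ((2 ^ Nat.clog 2 j - j : ℕ) : ℝ≥0∞) / ((2 ^ Nat.clog 2 j : ℕ) : ℝ≥0∞)

/-- The probability that a round of rejection sampling from `{1, …, j}` succeeds. -/
noncomputable def success (j : ℕ) : ℝ≥0∞ := (j : ℝ≥0∞) / ((2 ^ Nat.clog 2 j : ℕ) : ℝ≥0∞)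

theorem two_pow_ne_zero (L : ℕ) : ((2 ^ L : ℕ) : ℝ≥0∞) ≠ 0 := by
  exact_mod_cast (Nat.two_pow_pos L).ne'

theorem mul_failure (j : ℕ) : ((2 ^ Nat.clog 2 j : ℕ) : ℝ≥0∞) * failure j =
    ((2 ^ Nat.clog 2 j - j : ℕ) : ℝ≥0∞) :=
  ENNReal.mul_div_cancel (two_pow_ne_zero _) (ENNReal.natCast_ne_top _)

theorem mul_success (j : ℕ) : ((2 ^ Nat.clog 2 j : ℕ) : ℝ≥0∞) * success j = j :=
  ENNReal.mul_div_cancel (two_pow_ne_zero _) (ENNReal.natCast_ne_top _)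

theorem failure_add_success (j : ℕ) : failure j + success j = 1 := by
  rw [failure, success, ENNReal.div_add_div_same, ← Nat.cast_add,
    Nat.sub_add_cancel (le_two_pow_clog j),
    ENNReal.div_self (two_pow_ne_zero _) (ENNReal.natCast_ne_top _)]

theorem success_ne_zero {j : ℕ} (hj : 1 ≤ j) : success j ≠ 0 :=
  ENNReal.div_ne_zero.2 ⟨by exact_mod_cast (by omega : j ≠ 0), ENNReal.natCast_ne_top _⟩

theorem two_mul_failure_le {j : ℕ} (hj : 1 ≤ j) : 2 * failure j ≤ 1 := by
  rw [failure, ← mul_div_assoc]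
  refine ENNReal.div_le_of_le_mul ?_
  rw [one_mul]
  have h := two_pow_clog_le hj
  generalize 2 ^ Nat.clog 2 j = J at h ⊢
  exact_mod_cast (by omega : 2 * (J - j) ≤ J)

/-- Rejection sampling from `{1, …, j}`: the number of failures is geometrically distributed, and
the result is uniform. -/
noncomputable def rejectionSample (j : ℕ) : Timed ℕ :=
  if hj : 1 ≤ j then
    ⟨(geometric _ _ (failure_add_success j) (success_ne_zero hj)).bind fun t =>
      PMF.map (fun x => (x, Nat.clog 2 j * (t + 1)))
        (PMF.uniformOfFinset (Finset.Icc 1 j) (Finset.nonempty_Icc.mpr hj))⟩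
  else pure 0

theorem law_rejectionSample {j : ℕ} (hj : 1 ≤ j) : (rejectionSample j).law =
    (geometric _ _ (failure_add_success j) (success_ne_zero hj)).bind fun t =>
      PMF.map (fun x => (x, Nat.clog 2 j * (t + 1)))
        (PMF.uniformOfFinset (Finset.Icc 1 j) (Finset.nonempty_Icc.mpr hj)) := by
  rw [rejectionSample, dif_pos hj]

theorem jointExpect_rejectionSample {j : ℕ} (hj : 1 ≤ j) (g : ℕ × ℕ → ℝ≥0∞) :
    jointExpect (rejectionSample j) g =
      ∑' t, geometric _ _ (failure_add_success j) (success_ne_zero hj) t *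
        ∑' x, PMF.uniformOfFinset (Finset.Icc 1 j) (Finset.nonempty_Icc.mpr hj) x *
          g (x, Nat.clog 2 j * (t + 1)) := by
  rw [jointExpect, law_rejectionSample hj, tsum_pmf_bind_mul]
  simp_rw [tsum_pmf_map_mul]

/-- Condition on the first round: no failure gives a uniform value, and after a failure the number
of further failures is again geometric. All is multiplied by `2 ^ Nat.clog 2 j` to count bit
patterns. -/
theorem rejectionSample_eq {j : ℕ} (hj : 1 ≤ j) :
    rejectionSample j = rejectionRound j (rejectionSample j) := by
  refine Timed.ext_jointExpect fun g => ?_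
  have h0 := two_pow_ne_zero (Nat.clog 2 j)
  refine (ENNReal.mul_right_inj h0 (ENNReal.natCast_ne_top _)).1 ?_
  rw [rejectionRound, jointExpect_bind, mul_jointExpect_randomBits]
  have hle := le_two_pow_clog j
  obtain ⟨d, hd⟩ := Nat.exists_eq_add_of_le hle
  have hfail := mul_failure j
  rw [jointExpect_rejectionSample hj, tsum_geometric_mul, mul_add, ← mul_assoc, ← mul_assoc,
    mul_success, hfail, mul_tsum_uniform hj]
  rw [hd, Finset.sum_range_add, Nat.add_sub_cancel_left]
  congr 1
  · refine Finset.sum_congr rfl fun x hx => ?_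
    rw [if_pos (by simp at hx; omega), jointExpect_pure]
    simp
  · rw [Finset.sum_congr rfl (g := fun _ => jointExpect (rejectionSample j) fun z =>
      g (z.1, Nat.clog 2 j + z.2)) fun x hx => by rw [if_neg (by omega)]]
    rw [Finset.sum_const, Finset.card_range, nsmul_eq_mul, jointExpect_rejectionSample hj]
    simp only [mul_add, mul_one, add_comm, add_left_comm, add_assoc]

/-- The generator of random integers by rejection sampling from fair bits. -/
noncomputable def rejectionGenerator : UniformGenerator where
  draw := rejectionSample
  uniform j hj := by
    rw [output, law_rejectionSample hj, PMF.map_bind]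
    simp_rw [PMF.map_comp]
    have : ∀ t : ℕ, (Prod.fst ∘ fun x : ℕ => (x, Nat.clog 2 j * (t + 1))) = id := fun t => rfl
    simp_rw [this, PMF.map_id, PMF.bind_const]
  one_le_time j hj y hy := by
    rw [law_rejectionSample (by omega), PMF.mem_support_bind_iff] at hy
    obtain ⟨t, -, hy⟩ := hy
    obtain ⟨x, -, rfl⟩ := (PMF.mem_support_map_iff _ _ _).1 hy
    have : 0 < Nat.clog 2 j := Nat.clog_pos one_lt_two hj
    exact Nat.mul_pos this (Nat.succ_pos t)

theorem expectedTime_rejectionSample_le {j : ℕ} (hj : 1 ≤ j) :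
    (rejectionSample j).expectedTime ≤ ((8 * Nat.clog 2 j : ℕ) : ℝ≥0∞) := by
  have h : (rejectionSample j).expectedTime =
      jointExpect (rejectionSample j) fun y => (y.2 : ℝ≥0∞) := rfl
  rw [h, jointExpect_rejectionSample hj]
  simp only [ENNReal.tsum_mul_right, PMF.tsum_coe, one_mul, Nat.cast_mul, Nat.cast_add,
    Nat.cast_one, mul_left_comm _ (Nat.clog 2 j : ℝ≥0∞), ENNReal.tsum_mul_left]
  rw [Nat.cast_ofNat, mul_comm (8 : ℝ≥0∞)]
  gcongr
  exact tsum_geometric_mul_add_one_le _ _ (two_mul_failure_le hj)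

theorem Tr_rejectionGenerator_le {k : ℕ} (hk : 2 ≤ k) :
    rejectionGenerator.Tr k ≤ ENNReal.ofReal ((32 : ℝ≥0) * Real.log k) := by
  refine iSup₂_le fun j hj => ?_
  rw [Finset.mem_Icc] at hj
  refine (expectedTime_rejectionSample_le hj.1).trans ?_
  rw [← ENNReal.ofReal_natCast]
  refine ENNReal.ofReal_le_ofReal ?_
  have h1 := clog_two_le hk
  have h2 : (Nat.clog 2 j : ℝ) ≤ Nat.clog 2 k := by exact_mod_cast Nat.clog_mono_right 2 hj.2
  push_cast
  linarith

end Rejection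
end MarginSampling

open MarginSampling
theorem lemma6p5 :
    -- the output is uniformly distributed
    (∀ (G : UniformGenerator) (κ : Kind) (m n : ℕ) (p : Fin m → ℕ) (q : Fin n → ℕ),
      ∑ i, p i = ∑ j, q j → (κ = Kind.binary → (tables κ p q).Nonempty) →
      ∀ X : Matrix (Fin m) (Fin n) ℕ,
        ((sample G κ p q).output.map toMatrix) X =
          (tables κ p q).indicator (fun _ => ((tables κ p q).ncard : ℝ≥0∞)⁻¹) X) ∧
    -- expected time, binary case
    (∃ C : ℝ≥0, ∀ (G : UniformGenerator) (m n : ℕ) (p : Fin m → ℕ) (q : Fin n → ℕ)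
      (a b c : ℕ), a = Finset.univ.sup p → b = Finset.univ.sup q →
      c = ∑ i, p i → c = ∑ j, q j → 1 ≤ c → (tables Kind.binary p q).Nonempty →
      (sample G Kind.binary p q).expectedTime ≤
        C * (m * G.Tr (n ^ c) + m * a * G.Tr n +
          ENNReal.ofReal (m * b * Real.log (a + b)))) ∧
    -- expected time, natural-number case
    (∃ C : ℝ≥0, ∀ (G : UniformGenerator) (m n : ℕ) (p : Fin m → ℕ) (q : Fin n → ℕ)
      (a b c : ℕ), a = Finset.univ.sup p → b = Finset.univ.sup q →
      c = ∑ i, p i → c = ∑ j, q j → 1 ≤ c →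
      (sample G Kind.natural p q).expectedTime ≤
        C * (m * G.Tr ((2 * c) ^ c) + m * a * G.Tr n +
          ENNReal.ofReal (m * b * Real.log (a + b)))) ∧
    -- expected time if the time to generate integers is logarithmic
    (∀ (K : ℝ≥0) (k₀ : ℕ), ∃ C : ℝ≥0, ∀ G : UniformGenerator,
      (∀ k, k₀ ≤ k → G.Tr k ≤ ENNReal.ofReal (K * Real.log k)) →
      ∀ (κ : Kind) (m n : ℕ) (p : Fin m → ℕ) (q : Fin n → ℕ) (c : ℕ),
      c = ∑ i, p i → c = ∑ j, q j → 2 ≤ c →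
      (κ = Kind.binary → (tables κ p q).Nonempty) →
      (sample G κ p q).expectedTime ≤ C * ENNReal.ofReal (m * c * Real.log c)) ∧
    -- rejection sampling from fair bits generates integers in logarithmic time
    (∃ G : UniformGenerator, (∀ j, 1 ≤ j → G.draw j = rejectionRound j (G.draw j)) ∧
      ∃ K : ℝ≥0, ∀ k, 2 ≤ k → G.Tr k ≤ ENNReal.ofReal (K * Real.log k)) := by
  have hne : ∀ {κ : Kind} {m n : ℕ} {p : Fin m → ℕ} {q : Fin n → ℕ}, ∑ i, p i = ∑ j, q j →
      (κ = Kind.binary → (tables κ p q).Nonempty) → (tables κ p q).Nonempty := by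
    intro κ m n p q h hκ
    cases κ
    · exact hκ rfl
    · exact nonempty_tables_natural h
  refine ⟨fun G κ m n p q h hκ X => output_sample_apply G (hne h hκ) X, ⟨38, ?_⟩, ⟨38, ?_⟩, ?_,
    rejectionGenerator, fun j hj => rejectionSample_eq hj, 32, fun k hk =>
      Tr_rejectionGenerator_le hk⟩
  · intro G m n p q a b c ha hb hp hq hc ht
    exact expectedTime_sample_le_of_pow_le G ha hb hp hq hc ht
      (Nat.pow_le_pow_left (min_le_left n c) c)
  · intro G m n p q a b c ha hb hp hq hc
    exact expectedTime_sample_le_of_pow_le G ha hb hp hq hc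
      (nonempty_tables_natural (hp.symm.trans hq))
      -- At most `c` columns are nonzero, so already `c ^ c` bounds the counts.
      (Nat.pow_le_pow_left ((min_le_right n c).trans (by omega)) c)
  · intro K k₀
    refine ⟨46 + 2 * Real.toNNReal (K * (1 + 2 * Real.log (k₀ + 1))), ?_⟩
    intro G hG κ m n p q c hp hq hc hκ
    exact expectedTime_sample_le_of_log G hG hp hq hc (hne (hp.symm.trans hq) hκ)
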